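/- **Setting.** Let $S$ be a finite inverse semigroup, i.e. a finite semigroup in which for every $x$ there is a unique $x^{-1}$ with $xx^{-1}x=x$ and $x^{-1}xx^{-1}=x^{-1}$. Order $S$ by $s\le t\iff s=et$ for some idempotent $e$, let $\mu$ be the Möbius function of this poset, and let $\lfloor s\rfloor=\sum_{t\le s}\mu(t,s)\,t\in\mathbb CS$; the family $\{\lfloor s\rfloor\}_{s\in S}$ is the groupoid basis of $\mathbb CS$. Two idempotents $a,b$ are isomorphic if $a=x^{-1}x$, $b=xx^{-1}$ for some $x\in S$, and $s\mathrel{\mathcal D}t$ means that $s^{-1}s$ and $t^{-1}t$ are isomorphic. Let $D_0,\dots,D_n$ be the $\mathcal D$-classes of $S$, let $r_k$ be the number of idempotents in $D_k$, choose an idempotent $e_k\in D_k$ for each $k$, and let $G_k=\{s\in S: s^{-1}s=ss^{-1}=e_k\}$ be the maximal subgroup of $S$ at $e_k$. A representation of $\mathbb CS$ is a (not necessarily unital) algebra homomorphism $\rho:\mathbb CS\to M_{d_\rho}(\mathbb C)$; it is irreducible if it is nonzero and simple as a module, and two representations are equivalent if they are conjugate by an invertible matrix. For a complete set $\mathcal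 Y$ of inequivalent irreducible representations, the Fourier transform of $v\in\mathbb CS$ with respect to $\mathcal Y$ is $\bigoplus_{\rho\in\mathcal Y}\rho(v)$. An operation is one complex multiplication followed by one complex addition, $a\cdot b+c$, applied to input numbers, complex constants (in particular precomputed ones) or earlier results; the cost of a computation (a straight-line program that works for every input) is its number of operations, and arranging numbers into matrices is free. For a finite group $G$, $\mathcal T_{\mathcal Y}(G)$ is the least number of operations that suffices to compute the Fourier transform with respect to $\mathcal Y$ of an arbitrary $f=\sum_{g\in G} f(g)g\in\mathbb CG$ from the numbers $f(g)$, and $\mathcal C(G)=\min_{\mathcal Y}\mathcal T_{\mathcal Y}(G)$, over all complete sets $\mathcal Y$ of inequivalent irreducible representations of $\mathbb CG$. **Theorem.** Let $v=\sum_{s\in S}v(s)\lfloor s\rfloor$ be an arbitrary element of $\mathbb CS$, given by its coefficients $v(s)$ in the groupoid basis. Then the number of operations needed to compute the Fourier transform of $v$ (with respect to a best choice of a complete set of inequivalent irreducible representations of $\mathbb CS$) is at most $$\sum_{k=0}^n r_k^2\,\mathcal C(G_k).$$ More precisely, for each $k$ and each idempotent $a\in D_k$ there is $p_a\in S$ with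 $p_a^{-1}p_a=e_k$ and $p_ap_a^{-1}=a$; and for every choice of such elements the following hold, where matrices in $M_{r_k}$ have their rows and columns indexed by the idempotents of $D_k$. 1. The linear map determined by $\Phi(\lfloor s\rfloor)=p_b^{-1}sp_a\,E_{b,a}\in M_{r_k}(\mathbb CG_k)$, for $s\in D_k$, $a=s^{-1}s$, $b=ss^{-1}$, is an algebra isomorphism $\mathbb CS\cong\bigoplus_{k=0}^n M_{r_k}(\mathbb CG_k)$. (It restricts to $\mathbb CD_k\cong M_{r_k}(\mathbb CG_k)$, where $\mathbb CD_k$ is the span of $\{\lfloor s\rfloor:s\in D_k\}$.) 2. For a representation $\rho$ of $\mathbb CG_k$ let $\bar\rho$ be the induced representation of $\mathbb CS$, which applies $\rho$ to each entry of the $k$-th component of $\Phi$. Then for all idempotents $a,b\in D_k$ the $(b,a)$ block of $\bar\rho(v)$ is the Fourier transform at $\rho$ of a function on $G_k$, namely $\bar\rho(v)_{b,a}=\sum_{g\in G_k}v(p_bgp_a^{-1})\rho(g)$. 3. If $\mathrm{IRR}(G_k)$ is, for each $k$, a complete set of inequivalent irreducible representations of $\mathbb CG_k$, then $\mathcal Y=\{\bar\rho:\rho\in\mathrm{IRR}(G_k),\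 0\le k\le n\}$ is a complete set of inequivalent irreducible representations of $\mathbb CS$, and the Fourier transform of $v$ with respect to $\mathcal Y$ can be computed in at most $\sum_{k=0}^n r_k^2\,\mathcal T_{\mathrm{IRR}(G_k)}(G_k)$ operations. -/

import Mathlib

universe u

/-! ### Inverse semigroups -/

/-- An inverse semigroup: every `x` has exactly one `y` with `x y x = x` and `y x y = y`,
and that `y` is written `x⁻¹`. -/
class InverseSemigroup (S : Type u) extends Semigroup S, Inv S where
  mul_inv_mul : ∀ x : S, x * x⁻¹ * x = x
  inv_mul_inv : ∀ x : S, x⁻¹ * x * x⁻¹ = x⁻¹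
  inv_unique : ∀ x y : S, x * y * x = x → y * x * y = y → y = x⁻¹

namespace InverseSemigroup

section Basic

variable {S : Type u} [InverseSemigroup S]

theorem inv_inv' (x : S) : (x⁻¹)⁻¹ = x :=
  (inv_unique x⁻¹ x (inv_mul_inv x) (mul_inv_mul x)).symm

theorem inv_idem {e : S} (he : IsIdempotentElem e) : e⁻¹ = e :=
  (inv_unique e e (by rw [he.eq, he.eq]) (by rw [he.eq, he.eq])).symm

theorem idem_inv_mul (x : S) : IsIdempotentElem (x⁻¹ * x) := by
  unfold IsIdempotentElem
  rw [← mul_assoc, inv_mul_inv]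

theorem idem_mul_inv (x : S) : IsIdempotentElem (x * x⁻¹) := by
  unfold IsIdempotentElem
  rw [← mul_assoc, mul_inv_mul]

theorem idem_mul {e f : S} (he : IsIdempotentElem e) (hf : IsIdempotentElem f) :
    IsIdempotentElem (e * f) := by
  have he' : e * e = e := he
  have hf' : f * f = f := hf
  have h1 := mul_inv_mul (e * f)
  have h2 := inv_mul_inv (e * f)
  set x := (e * f)⁻¹ with hx
  have key : f * x * e = x := by
    rw [hx]
    apply inv_unique
    · calc e * f * (f * x * e) * (e * f) = e * (f * f) * x * (e * e) * f := by
            simp only [mul_assoc]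
        _ = e * f * x * (e * f) := by rw [he', hf']; simp only [mul_assoc]
        _ = e * f := h1
    · calc f * x * e * (e * f) * (f * x * e) = f * (x * ((e * e) * (f * f)) * x) * e := by
            simp only [mul_assoc]
        _ = f * (x * (e * f) * x) * e := by rw [he', hf']
        _ = f * x * e := by rw [h2]
  have hxi : IsIdempotentElem x := by
    change x * x = x
    calc x * x = (f * x * e) * (f * x * e) := by rw [key]
      _ = f * (x * (e * f) * x) * e := by simp only [mul_assoc]
      _ = x := by rw [h2, key]
  have : e * f = x := by
    rw [← inv_idem hxi, hx, inv_inv']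
  rw [this]
  exact hxi

theorem idem_comm {e f : S} (he : IsIdempotentElem e) (hf : IsIdempotentElem f) :
    e * f = f * e := by
  have he' : e * e = e := he
  have hf' : f * f = f := hf
  have h1 : e * f * (e * f) = e * f := idem_mul he hf
  have h2 : f * e * (f * e) = f * e := idem_mul hf he
  have : f * e = (e * f)⁻¹ := by
    apply inv_unique
    · calc e * f * (f * e) * (e * f) = e * (f * f) * (e * e) * f := by simp only [mul_assoc]
        _ = e * f * (e * f) := by rw [he', hf']; simp only [mul_assoc]
        _ = e * f := h1
    · calc f * e * (e * f) * (f * e) = f * (e * e) * (f * f) * e := by simp only [mul_assoc]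
        _ = f * e * (f * e) := by rw [he', hf']; simp only [mul_assoc]
        _ = f * e := h2
  rw [this, inv_idem (idem_mul he hf)]

theorem mul_inv_rev' (x y : S) : (x * y)⁻¹ = y⁻¹ * x⁻¹ := by
  symm
  have hc : (y * y⁻¹) * (x⁻¹ * x) = (x⁻¹ * x) * (y * y⁻¹) :=
    idem_comm (idem_mul_inv y) (idem_inv_mul x)
  apply inv_unique
  · calc x * y * (y⁻¹ * x⁻¹) * (x * y) = x * ((y * y⁻¹) * (x⁻¹ * x)) * y := by
          simp only [mul_assoc]
      _ = (x * x⁻¹ * x) * (y * y⁻¹ * y) := by rw [hc]; simp only [mul_assoc]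
      _ = x * y := by rw [mul_inv_mul, mul_inv_mul]
  · calc y⁻¹ * x⁻¹ * (x * y) * (y⁻¹ * x⁻¹) = y⁻¹ * ((x⁻¹ * x) * (y * y⁻¹)) * x⁻¹ := by
          simp only [mul_assoc]
      _ = (y⁻¹ * y * y⁻¹) * (x⁻¹ * x * x⁻¹) := by rw [← hc]; simp only [mul_assoc]
      _ = y⁻¹ * x⁻¹ := by rw [inv_mul_inv, inv_mul_inv]

/-- The natural partial order: `s ≤ t` iff `s = e t` for some idempotent `e`. -/
@[reducible] def naturalOrder (S : Type u) [InverseSemigroup S] : PartialOrder S where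
  le s t := ∃ e : S, IsIdempotentElem e ∧ s = e * t
  le_refl s := ⟨s * s⁻¹, idem_mul_inv s, (mul_inv_mul s).symm⟩
  le_trans := by
    rintro a b c ⟨e, he, rfl⟩ ⟨f, hf, rfl⟩
    exact ⟨e * f, idem_mul he hf, (mul_assoc _ _ _).symm⟩
  le_antisymm := by
    rintro s t ⟨e, he, hs⟩ ⟨f, hf, ht⟩
    have he' : e * e = e := he
    have hes : e * s = s := by rw [hs, ← mul_assoc, he']
    calc s = e * t := hs
      _ = e * (f * s) := by rw [← ht]
      _ = f * (e * s) := by rw [← mul_assoc, idem_comm he hf, mul_assoc]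
      _ = t := by rw [hes, ← ht]

/-- The idempotents of `S`. -/
def Idem (S : Type u) [InverseSemigroup S] : Type u := {a : S // IsIdempotentElem a}

/-- `dom s = s⁻¹ s`. -/
def dom (s : S) : Idem S := ⟨s⁻¹ * s, idem_inv_mul s⟩

/-- `ran s = s s⁻¹`. -/
def ran (s : S) : Idem S := ⟨s * s⁻¹, idem_mul_inv s⟩

/-- Two idempotents are isomorphic if `a = x⁻¹ x` and `b = x x⁻¹` for some `x`. -/
def IsoIdem (a b : Idem S) : Prop := ∃ x : S, dom x = a ∧ ran x = b

theorem IsoIdem.refl (a : Idem S) : IsoIdem a a :=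
  ⟨a.1, Subtype.ext (by change a.1⁻¹ * a.1 = a.1; rw [inv_idem a.2, a.2.eq]),
    Subtype.ext (by change a.1 * a.1⁻¹ = a.1; rw [inv_idem a.2, a.2.eq])⟩

theorem IsoIdem.symm {a b : Idem S} (h : IsoIdem a b) : IsoIdem b a := by
  obtain ⟨x, rfl, rfl⟩ := h
  exact ⟨x⁻¹, Subtype.ext (by simp only [dom, ran, inv_inv']),
    Subtype.ext (by simp only [dom, ran, inv_inv'])⟩

theorem IsoIdem.trans {a b c : Idem S} (h : IsoIdem a b) (h' : IsoIdem b c) : IsoIdem a c := by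
  obtain ⟨x, rfl, hx⟩ := h
  obtain ⟨y, hy, rfl⟩ := h'
  have hxy : y⁻¹ * y = x * x⁻¹ := congrArg Subtype.val (hy.trans hx.symm)
  refine ⟨y * x, Subtype.ext ?_, Subtype.ext ?_⟩
  · change (y * x)⁻¹ * (y * x) = x⁻¹ * x
    calc (y * x)⁻¹ * (y * x) = x⁻¹ * (y⁻¹ * y) * x := by
          rw [mul_inv_rev']; simp only [mul_assoc]
      _ = (x⁻¹ * x * x⁻¹) * x := by rw [hxy]; simp only [mul_assoc]
      _ = x⁻¹ * x := by rw [inv_mul_inv]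
  · change (y * x) * (y * x)⁻¹ = y * y⁻¹
    calc (y * x) * (y * x)⁻¹ = y * (x * x⁻¹) * y⁻¹ := by
          rw [mul_inv_rev']; simp only [mul_assoc]
      _ = (y * y⁻¹ * y) * y⁻¹ := by rw [← hxy]; simp only [mul_assoc]
      _ = y * y⁻¹ := by rw [mul_inv_mul]

/-- Green's relation `𝒟`: `s 𝒟 t` iff `s⁻¹ s` and `t⁻¹ t` are isomorphic idempotents. -/
def dSetoid (S : Type u) [InverseSemigroup S] : Setoid S where
  r s t := IsoIdem (dom s) (dom t)
  iseqv := ⟨fun _ => IsoIdem.refl _, fun h => h.symm, fun h h' => h.trans h'⟩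

/-- The set of `𝒟`-classes of `S`. -/
def DClass (S : Type u) [InverseSemigroup S] : Type u := Quotient (dSetoid S)

/-- The `𝒟`-class of an element; `s ∈ D_k` is expressed as `dClass s = k`. -/
def dClass (s : S) : DClass S := Quotient.mk (dSetoid S) s

theorem dClass_eq_iff {s t : S} : dClass s = dClass t ↔ IsoIdem (dom s) (dom t) :=
  Quotient.eq (r := dSetoid S)

theorem dom_idem (a : Idem S) : dom a.1 = a :=
  Subtype.ext (by change a.1⁻¹ * a.1 = a.1; rw [inv_idem a.2, a.2.eq])

theorem dClass_dom (s : S) : dClass (dom s).1 = dClass s := by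
  rw [dClass_eq_iff, dom_idem]
  exact IsoIdem.refl _

theorem dClass_ran (s : S) : dClass (ran s).1 = dClass s := by
  rw [dClass_eq_iff, dom_idem]
  exact IsoIdem.symm ⟨s, rfl, rfl⟩

/-- The idempotents lying in the `𝒟`-class `k`. -/
def DIdem (k : DClass S) : Type u := {a : Idem S // dClass a.1 = k}

/-- `s⁻¹ s` as an idempotent of the `𝒟`-class of `s`. -/
def domD (s : S) : DIdem (dClass s) := ⟨dom s, dClass_dom s⟩

/-- `s s⁻¹` as an idempotent of the `𝒟`-class of `s`. -/
def ranD (s : S) : DIdem (dClass s) := ⟨ran s, dClass_ran s⟩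

/-- The maximal subgroup at the idempotent `e`. -/
def MaxSubgroup (e : Idem S) : Type u := {s : S // dom s = e ∧ ran s = e}

theorem MaxSubgroup.inv_mul {e : Idem S} (x : MaxSubgroup e) : x.1⁻¹ * x.1 = e.1 :=
  congrArg Subtype.val x.2.1

theorem MaxSubgroup.mul_inv {e : Idem S} (x : MaxSubgroup e) : x.1 * x.1⁻¹ = e.1 :=
  congrArg Subtype.val x.2.2

theorem MaxSubgroup.one_mul' {e : Idem S} (x : MaxSubgroup e) : e.1 * x.1 = x.1 := by
  rw [← x.mul_inv, mul_inv_mul]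

theorem MaxSubgroup.mul_one' {e : Idem S} (x : MaxSubgroup e) : x.1 * e.1 = x.1 := by
  rw [← x.inv_mul, ← mul_assoc, mul_inv_mul]

instance (e : Idem S) : Group (MaxSubgroup e) where
  mul x y := ⟨x.1 * y.1, by
    constructor
    · refine Subtype.ext ?_
      change (x.1 * y.1)⁻¹ * (x.1 * y.1) = e.1
      calc (x.1 * y.1)⁻¹ * (x.1 * y.1) = y.1⁻¹ * ((x.1⁻¹ * x.1) * y.1) := by
            rw [mul_inv_rev']; simp only [mul_assoc]
        _ = e.1 := by rw [x.inv_mul, y.one_mul', y.inv_mul]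
    · refine Subtype.ext ?_
      change (x.1 * y.1) * (x.1 * y.1)⁻¹ = e.1
      calc (x.1 * y.1) * (x.1 * y.1)⁻¹ = (x.1 * (y.1 * y.1⁻¹)) * x.1⁻¹ := by
            rw [mul_inv_rev']; simp only [mul_assoc]
        _ = e.1 := by rw [y.mul_inv, x.mul_one', x.mul_inv]⟩
  one := ⟨e.1, dom_idem e, Subtype.ext (by
    change e.1 * e.1⁻¹ = e.1; rw [inv_idem e.2, e.2.eq])⟩
  inv x := ⟨x.1⁻¹, Subtype.ext (by
    change x.1⁻¹⁻¹ * x.1⁻¹ = e.1; rw [inv_inv', x.mul_inv]), Subtype.ext (by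
    change x.1⁻¹ * x.1⁻¹⁻¹ = e.1; rw [inv_inv', x.inv_mul])⟩
  mul_assoc x y z := Subtype.ext (mul_assoc x.1 y.1 z.1)
  one_mul x := Subtype.ext x.one_mul'
  mul_one x := Subtype.ext x.mul_one'
  inv_mul_cancel x := Subtype.ext x.inv_mul

/-- `MaxSubgroup e` is the largest subset of `S` that contains `e` and is a group under the
multiplication of `S`: it is a group by the instance above, and every such subset lies in it. -/
theorem subset_maxSubgroup (e : Idem S) (H : Set S)
    (hone : ∀ x ∈ H, e.1 * x = x ∧ x * e.1 = x)
    (hinv : ∀ x ∈ H, ∃ y ∈ H, x * y = e.1 ∧ y * x = e.1) :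
    ∀ x ∈ H, dom x = e ∧ ran x = e := by
  intro x hx
  obtain ⟨y, hy, h1, h2⟩ := hinv x hx
  have : y = x⁻¹ := inv_unique x y (by rw [h1, (hone x hx).1]) (by rw [h2, (hone y hy).1])
  subst this
  exact ⟨Subtype.ext h2, Subtype.ext h1⟩

/-- A choice, for every idempotent `a` of every `𝒟`-class `k`, of an isomorphism `p_a` from the
chosen idempotent `e_k` to `a`, i.e. `p_a⁻¹ p_a = e_k` and `p_a p_a⁻¹ = a`. -/
structure IsoChoice (e : ∀ k : DClass S, DIdem k) where
  p : ∀ k : DClass S, DIdem k → S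
  dom_p : ∀ k a, dom (p k a) = (e k).1
  ran_p : ∀ k a, ran (p k a) = a.1

/-- `p_b⁻¹ s p_a`, where `a = s⁻¹ s` and `b = s s⁻¹`, as an element of the maximal subgroup
at `e_k`, where `k` is the `𝒟`-class of `s`. -/
def IsoChoice.conj {e : ∀ k : DClass S, DIdem k} (c : IsoChoice e) (s : S) :
    MaxSubgroup (e (dClass s)).1 :=
  ⟨(c.p _ (ranD s))⁻¹ * s * c.p _ (domD s), by
    have ha : IsoIdem (dom s) (dom s) := IsoIdem.refl _
    have h1 := congrArg Subtype.val (c.dom_p _ (ranD s))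
    have h2 := congrArg Subtype.val (c.ran_p _ (ranD s))
    have h3 := congrArg Subtype.val (c.dom_p _ (domD s))
    have h4 := congrArg Subtype.val (c.ran_p _ (domD s))
    simp only [dom, ran, ranD, domD] at h1 h2 h3 h4
    set q := c.p (dClass s) (ranD s) with hq
    set r := c.p (dClass s) (domD s) with hr
    change q⁻¹ * q = (e (dClass s)).1.1 at h1
    change q * q⁻¹ = s * s⁻¹ at h2
    change r⁻¹ * r = (e (dClass s)).1.1 at h3
    change r * r⁻¹ = s⁻¹ * s at h4
    constructor
    · refine Subtype.ext ?_
      change (q⁻¹ * s * r)⁻¹ * (q⁻¹ * s * r) = (e (dClass s)).1.1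
      rw [← h3, mul_inv_rev', mul_inv_rev', inv_inv']
      calc r⁻¹ * (s⁻¹ * q) * (q⁻¹ * s * r) = r⁻¹ * s⁻¹ * (q * q⁻¹) * s * r := by
            simp only [mul_assoc]
        _ = r⁻¹ * (s⁻¹ * s * s⁻¹) * s * r := by rw [h2]; simp only [mul_assoc]
        _ = r⁻¹ * (s⁻¹ * s) * r := by rw [inv_mul_inv]; simp only [mul_assoc]
        _ = (r⁻¹ * r * r⁻¹) * r := by rw [← h4]; simp only [mul_assoc]
        _ = r⁻¹ * r := by rw [inv_mul_inv]
    · refine Subtype.ext ?_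
      change (q⁻¹ * s * r) * (q⁻¹ * s * r)⁻¹ = (e (dClass s)).1.1
      rw [← h1, mul_inv_rev', mul_inv_rev', inv_inv']
      calc q⁻¹ * s * r * (r⁻¹ * (s⁻¹ * q)) = q⁻¹ * s * (r * r⁻¹) * s⁻¹ * q := by
            simp only [mul_assoc]
        _ = q⁻¹ * (s * s⁻¹ * s) * s⁻¹ * q := by rw [h4]; simp only [mul_assoc]
        _ = q⁻¹ * (s * s⁻¹) * q := by rw [mul_inv_mul]; simp only [mul_assoc]
        _ = (q⁻¹ * q * q⁻¹) * q := by rw [← h2]; simp only [mul_assoc]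
        _ = q⁻¹ * q := by rw [inv_mul_inv]⟩

end Basic

noncomputable section Finiteness

variable {S : Type u} [InverseSemigroup S] [Fintype S]

instance : Fintype (DClass S) :=
  haveI : Finite (DClass S) := Quotient.finite (dSetoid S)
  Fintype.ofFinite _

instance : Fintype (Idem S) :=
  haveI : Finite (Idem S) := Subtype.finite
  Fintype.ofFinite _

instance (k : DClass S) : Fintype (DIdem k) :=
  haveI : Finite (DIdem k) := Subtype.finite
  Fintype.ofFinite _

instance (k : DClass S) : DecidableEq (DIdem k) := Classical.decEq _

instance : DecidableEq (DClass S) := Classical.decEq _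

instance (e : Idem S) : Fintype (MaxSubgroup e) :=
  haveI : Finite (MaxSubgroup e) := Subtype.finite
  Fintype.ofFinite _

/-- The groupoid basis element `⌊s⌋ = ∑_{t ≤ s} μ(t, s) t`, with `μ` the Möbius function of the
natural partial order. -/
def groupoidElem (s : S) : MonoidAlgebra ℂ S :=
  letI := naturalOrder S
  letI : DecidableEq S := Classical.decEq S
  letI : DecidableLE S := Classical.decRel _
  letI : DecidableLT S := Classical.decRel _
  letI : LocallyFiniteOrder S := Fintype.toLocallyFiniteOrder
  ∑ t : S with t ≤ s, MonoidAlgebra.single t (IncidenceAlgebra.mu ℂ t s)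

end Finiteness

end InverseSemigroup

/-! ### Matrix representations -/

/-- A representation of an algebra `A` (not required to have an identity) by complex matrices of
size `dim`: an algebra homomorphism `A → M_dim(ℂ)`; null representations are allowed. -/
structure MatRep (A : Type u) [NonUnitalRing A] [Module ℂ A] where
  dim : ℕ
  hom : A →ₙₐ[ℂ] Matrix (Fin dim) (Fin dim) ℂ

namespace MatRep

variable {A : Type u} [NonUnitalRing A] [Module ℂ A]

/-- `ρ` is non-null and simple as a left module. -/
def Irreducible (ρ : MatRep A) : Prop :=
  (∃ a, ρ.hom a ≠ 0) ∧
    ∀ W : Submodule ℂ (Fin ρ.dim → ℂ),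
      (∀ a, ∀ w ∈ W, Matrix.mulVec (ρ.hom a) w ∈ W) → W = ⊥ ∨ W = ⊤

/-- `X ρ(a) X⁻¹ = σ(a)` for an invertible matrix `X`. -/
def Equivalent (ρ σ : MatRep A) : Prop :=
  ∃ (X : Matrix (Fin σ.dim) (Fin ρ.dim) ℂ) (X' : Matrix (Fin ρ.dim) (Fin σ.dim) ℂ),
    X * X' = 1 ∧ X' * X = 1 ∧ ∀ a, X * ρ.hom a * X' = σ.hom a

/-- `Y` is a complete set of inequivalent, irreducible representations of `A`. -/
def IsComplete (Y : Set (MatRep A)) : Prop :=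
  (∀ ρ ∈ Y, ρ.Irreducible) ∧
  (∀ ρ ∈ Y, ∀ σ ∈ Y, ρ.Equivalent σ → ρ = σ) ∧
  (∀ σ : MatRep A, σ.Irreducible → ∃ ρ ∈ Y, ρ.Equivalent σ)

/-- The index set of the matrix entries of `⨁_{ρ ∈ Y} M_{d_ρ}(ℂ)`. -/
abbrev EntryIndex (Y : Set (MatRep A)) : Type u := Σ ρ : Y, Fin ρ.1.dim × Fin ρ.1.dim

/-- The Fourier transform `⨁_{ρ ∈ Y} ρ(v)` of `v ∈ A` with respect to `Y`, given by its entries. -/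
def fourier (Y : Set (MatRep A)) (v : A) : EntryIndex Y → ℂ :=
  fun x => x.1.1.hom v x.2.1 x.2.2

end MatRep

/-! ### Computations and operation counts -/

/-- A value available during a computation: a complex constant (in particular any precomputed
number), one of the input numbers, or the result of the `i`-th operation. -/
inductive Operand (X : Type u) : Type u where
  | const : ℂ → Operand X
  | input : X → Operand X
  | result : ℕ → Operand X

/-- One operation: a complex multiplication followed by a complex addition, `a * b + c`. -/
structure Operation (X : Type u) : Type u where
  a : Operand X
  b : Operand X
  c : Operand X

/-- A straight-line program with inputs indexed by `X`; the number of operations is its length. -/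
abbrev Program (X : Type u) : Type u := List (Operation X)

/-- The value of an operand, for input numbers `f` and results `mem` of the operations performed so
far (a result that does not exist reads as the constant `0`). -/
def Operand.eval {X : Type u} (f : X → ℂ) (mem : List ℂ) : Operand X → ℂ
  | .const z => z
  | .input x => f x
  | .result i => mem.getD i 0

/-- The list of the results of all operations, performed in order on the input numbers `f`. -/
def Program.run {X : Type u} (P : Program X) (f : X → ℂ) : List ℂ :=
  P.foldl (fun mem o => mem ++ [o.a.eval f mem * o.b.eval f mem + o.c.eval f mem]) []

/-- `P` computes the numbers `F f j`, `j : J`, from every input `f`: each of them is available, at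
a place that does not depend on `f`, when `P` has been run. -/
def Program.Computes {X : Type u} {J : Type u} (P : Program X) (F : (X → ℂ) → J → ℂ) : Prop :=
  ∀ j : J, ∃ o : Operand X, ∀ f : X → ℂ, o.eval f (P.run f) = F f j

/-- The number of operations needed to compute `F` (`⊤` if no program computes it). -/
noncomputable def opCount {X : Type u} {J : Type u} (F : (X → ℂ) → J → ℂ) : ℕ∞ :=
  ⨅ (P : Program X) (_ : P.Computes F), (P.length : ℕ∞)

noncomputable section Cost

/-- The number of operations needed to compute the Fourier transform, with respect to `Y`, of an
arbitrary `v = ∑ x, f x • b x` that is given by its coefficients `f` in the family `b`. -/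
def fourierCost {A : Type u} [NonUnitalRing A] [Module ℂ A] {X : Type u} [Fintype X]
    (b : X → A) (Y : Set (MatRep A)) : ℕ∞ :=
  opCount (fun f : X → ℂ => MatRep.fourier Y (∑ x, f x • b x))

/-- `𝒯_Y(S)`: elements of `ℂ S` are given in the semigroup basis. -/
def semigroupCost (S : Type u) [Semigroup S] [Fintype S]
    (Y : Set (MatRep (MonoidAlgebra ℂ S))) : ℕ∞ :=
  fourierCost (fun s : S => (MonoidAlgebra.single s 1 : MonoidAlgebra ℂ S)) Y

/-- `𝒞(S)`: the minimum of `𝒯_Y(S)` over all complete sets `Y` of inequivalent, irreducible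
representations of `ℂ S`. -/
def semigroupComplexity (S : Type u) [Semigroup S] [Fintype S] : ℕ∞ :=
  ⨅ (Y : Set (MatRep (MonoidAlgebra ℂ S))) (_ : MatRep.IsComplete Y), semigroupCost S Y

namespace InverseSemigroup

variable {S : Type u} [InverseSemigroup S] [Fintype S]

/-- The number of operations needed to compute the Fourier transform with respect to `Y` of an
element `∑ s, v s ⌊s⌋` given in the groupoid basis. -/
def groupoidCost (Y : Set (MatRep (MonoidAlgebra ℂ S))) : ℕ∞ :=
  fourierCost (fun s : S => groupoidElem s) Y

/-- The number of operations needed to compute the Fourier transform of an element given in the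
groupoid basis, for a best choice of the complete set of representations. -/
def groupoidComplexity (S : Type u) [InverseSemigroup S] [Fintype S] : ℕ∞ :=
  ⨅ (Y : Set (MatRep (MonoidAlgebra ℂ S))) (_ : MatRep.IsComplete Y), groupoidCost Y

/-- `r_k`: the number of idempotents in the `𝒟`-class `k`. -/
def numIdem (k : DClass S) : ℕ := Fintype.card (DIdem k)

/-- The algebra `⨁_k M_{r_k}(ℂ G_k)`; rows and columns of the `k`-th summand are indexed by the
idempotents in `D_k`. -/
abbrev BlockAlgebra (e : ∀ k : DClass S, DIdem k) : Type u :=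
  ∀ k : DClass S, Matrix (DIdem k) (DIdem k) (MonoidAlgebra ℂ (MaxSubgroup (e k).1))

/-- The numbering of the pairs (idempotent of `D_k`, row of a `d × d` matrix) that turns an
`r_k × r_k` matrix of `d × d` blocks into an `(r_k d) × (r_k d)` matrix, for a numbering `ν` of the
idempotents of `D_k`. -/
def blockIndex {k : DClass S} (ν : DIdem k ≃ Fin (numIdem k)) (d : ℕ) :
    DIdem k × Fin d ≃ Fin (numIdem k * d) :=
  (ν.prodCongr (Equiv.refl (Fin d))).trans finProdFinEquiv

/-- Given an algebra homomorphism `Φ : ℂ S → ⨁_k M_{r_k}(ℂ G_k)` and a representation `ρ` of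
`ℂ G_k`, the representation of `ℂ S` that applies `ρ` to every entry of the `k`-th component
of `Φ`. -/
def induced {e : ∀ k : DClass S, DIdem k} (Φ : MonoidAlgebra ℂ S →ₙₐ[ℂ] BlockAlgebra e)
    (ν : ∀ k : DClass S, DIdem k ≃ Fin (numIdem k)) (k : DClass S)
    (ρ : MatRep (MonoidAlgebra ℂ (MaxSubgroup (e k).1))) : MatRep (MonoidAlgebra ℂ S) where
  dim := numIdem k * ρ.dim
  hom :=
    { toFun := fun v => Matrix.of fun i j =>
        ρ.hom (Φ v k ((blockIndex (ν k) ρ.dim).symm i).1 ((blockIndex (ν k) ρ.dim).symm j).1)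
          ((blockIndex (ν k) ρ.dim).symm i).2 ((blockIndex (ν k) ρ.dim).symm j).2
      map_smul' := by
        intro c v
        ext i j
        simp
      map_zero' := by
        ext i j
        simp
      map_add' := by
        intro v w
        ext i j
        simp
      map_mul' := by
        intro v w
        ext i j
        simp only [map_mul, Pi.mul_apply, Matrix.of_apply, Matrix.mul_apply, map_sum,
          Matrix.sum_apply]
        rw [← Fintype.sum_prod_type', ← (blockIndex (ν k) ρ.dim).sum_comp]
        simp }

end InverseSemigroup

end Cost

open InverseSemigroup (DClass DIdem MaxSubgroup IsoChoice BlockAlgebra dClass domD ranD numIdem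
  groupoidElem groupoidCost groupoidComplexity induced blockIndex)

/-! Every element of `S` is `p_b g p_a⁻¹` for exactly one class `k`, idempotents `b`, `a` of `D_k`
and `g ∈ G_k`, and composable elements of this form multiply like matrix units with coefficients in
`G_k`. Send `s` to the family of matrices whose `(b, a)` entry is the sum of those `g` with `p_b g
p_a⁻¹ ≤ s`. This is multiplicative (`IsoChoice.blockOf_mul`) because an element of range `b` lies
below `s s'` exactly when it splits into composable factors below `s` and `s'`, and the splitting is
unique. Thus `s` goes to the sum of the matrix units of all `t ≤ s`, and Möbius inversion sends
`⌊s⌋` to the single matrix unit of `s`. The groupoid basis therefore matches a basis of the block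
algebra, and the homomorphism is bijective (`IsoChoice.blockHom_bijective`).

Irreducibles of a sum of matrix algebras over the `ℂ G_k` come from irreducibles of the `ℂ G_k`: an
irreducible `σ` is nonzero on some corner `E_{e_k,e_k}`, the image of that corner is an irreducible
of `ℂ G_k`, and inducing it gives `σ` back (`isComplete_induced`).

For the cost, the `(b, a)` entry of the image of `v` has the numbers `v(p_b g p_a⁻¹)` as
coefficients. They are inputs under new names, so passing to the blocks is free, and `r_k²` group
transforms for each `k`, run one after another, yield every output (`opCount_le_sum`). -/

/-! ### Combining straight-line programs -/

/-- Rename the inputs of an operand. -/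
def Operand.rename {X Y : Type u} (m : X → Y) : Operand X → Operand Y
  | .const z => .const z
  | .input x => .input (m x)
  | .result i => .result i

/-- Shift all references to earlier results by `n`. -/
def Operand.shift {X : Type u} (n : ℕ) : Operand X → Operand X
  | .const z => .const z
  | .input x => .input x
  | .result i => .result (n + i)

/-- Replace references to results that do not exist by the constant `0`. -/
def Operand.clip {X : Type u} (n : ℕ) : Operand X → Operand X
  | .const z => .const z
  | .input x => .input x
  | .result i => if i < n then .result i else .const 0

/-- Apply a transformation to the three operands of an operation. -/
def Operation.mapOperands {X Y : Type u} (φ : Operand X → Operand Y) (o : Operation X) :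
    Operation Y :=
  ⟨φ o.a, φ o.b, φ o.c⟩

theorem Operand.eval_rename {X Y : Type u} (m : X → Y) (f : Y → ℂ) (mem : List ℂ)
    (o : Operand X) : (o.rename m).eval f mem = o.eval (f ∘ m) mem := by
  cases o <;> rfl

theorem Operand.eval_shift {X : Type u} (f : X → ℂ) (mem₀ mem : List ℂ) (o : Operand X) :
    (o.shift mem₀.length).eval f (mem₀ ++ mem) = o.eval f mem := by
  cases o with
  | const z => rfl
  | input x => rfl
  | result i => simp [Operand.shift, Operand.eval, List.getElem?_append_right]

theorem Operand.eval_clip {X : Type u} (f : X → ℂ) (mem mem' : List ℂ) (o : Operand X) :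
    (o.clip mem.length).eval f (mem ++ mem') = o.eval f mem := by
  cases o with
  | const z => rfl
  | input x => rfl
  | result i =>
    by_cases h : i < mem.length
    · simp [Operand.clip, Operand.eval, h, List.getElem?_append_left]
    · simp [Operand.clip, Operand.eval, h]

theorem Program.run_length {X : Type u} (P : Program X) (f : X → ℂ) :
    (P.run f).length = P.length := by
  suffices ∀ mem : List ℂ, (P.foldl (fun mem o =>
      mem ++ [o.a.eval f mem * o.b.eval f mem + o.c.eval f mem]) mem).length =
      mem.length + P.length by
    simpa [Program.run] using this []
  induction P with
  | nil => simp
  | cons o P ih => intro mem; rw [List.foldl_cons, ih]; simp; ring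

theorem Program.run_rename {X Y : Type u} (m : X → Y) (P : Program X) (f : Y → ℂ) :
    Program.run (P.map (Operation.mapOperands (Operand.rename m))) f = P.run (f ∘ m) := by
  unfold Program.run
  rw [List.foldl_map]
  simp only [Operation.mapOperands, Operand.eval_rename]

theorem Program.run_append_shift {X : Type u} (P Q : Program X) (f : X → ℂ) :
    Program.run (P ++ Q.map (Operation.mapOperands (Operand.shift P.length))) f =
      P.run f ++ Q.run f := by
  have key : ∀ mem₀ mem : List ℂ,
      (Q.map (Operation.mapOperands (Operand.shift mem₀.length))).foldl (fun mem o =>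
        mem ++ [o.a.eval f mem * o.b.eval f mem + o.c.eval f mem]) (mem₀ ++ mem) =
      mem₀ ++ Q.foldl (fun mem o =>
        mem ++ [o.a.eval f mem * o.b.eval f mem + o.c.eval f mem]) mem := by
    intro mem₀
    induction Q with
    | nil => simp
    | cons o Q ih =>
      intro mem
      rw [List.map_cons, List.foldl_cons, List.foldl_cons, ← ih]
      simp only [Operation.mapOperands, Operand.eval_shift, List.append_assoc]
  have := key (P.run f) []
  rw [List.append_nil, Program.run_length] at this
  unfold Program.run at this ⊢
  rw [List.foldl_append, this]

/-- Running a finite family of programs one after the other: every operand of every member of the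
family is available at the end. -/
theorem Program.exists_concat {X : Type u} {I : Type*} (s : Finset I) (P : I → Program X) :
    ∃ Q : Program X, Q.length = ∑ i ∈ s, (P i).length ∧
      ∀ i ∈ s, ∀ o : Operand X, ∃ o' : Operand X, ∀ f : X → ℂ,
        o'.eval f (Q.run f) = o.eval f ((P i).run f) := by
  classical
  induction s using Finset.induction_on with
  | empty => exact ⟨[], by simp, by simp⟩
  | insert i s hi ih =>
    obtain ⟨Q, hQ, hQ'⟩ := ih
    refine ⟨P i ++ Q.map (Operation.mapOperands (Operand.shift (P i).length)), ?_, ?_⟩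
    · rw [Finset.sum_insert hi, ← hQ]; simp
    · intro j hj o
      rcases Finset.mem_insert.1 hj with rfl | hj
      -- A reference past the end of `P j` reads as `0`, but after concatenation it could hit a
      -- result of `Q`; clipping keeps the value `0`.
      · refine ⟨o.clip (P j).length, fun f => ?_⟩
        rw [Program.run_append_shift, ← Program.run_length (P j) f, Operand.eval_clip]
      · obtain ⟨o', ho'⟩ := hQ' j hj o
        refine ⟨o'.shift (P i).length, fun f => ?_⟩
        rw [Program.run_append_shift, ← Program.run_length (P i) f, Operand.eval_shift, ho']

theorem opCount_le {X J : Type u} {F : (X → ℂ) → J → ℂ} {P : Program X} (hP : P.Computes F) :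
    opCount F ≤ P.length :=
  iInf₂_le P hP

/-- A nonempty infimum in `ℕ∞` is attained, and a finite value excludes the empty one. -/
theorem exists_program_of_opCount_ne_top {X J : Type u} {F : (X → ℂ) → J → ℂ}
    (h : opCount F ≠ ⊤) : ∃ P : Program X, P.Computes F ∧ (P.length : ℕ∞) = opCount F := by
  have hne : Nonempty {P : Program X // P.Computes F} := by
    by_contra hcon
    apply h
    refine iInf₂_eq_top.2 fun P hP => (hcon ⟨⟨P, hP⟩⟩).elim
  obtain ⟨P, hP⟩ := ENat.exists_eq_iInf
    (fun P : {P : Program X // P.Computes F} => (P.1.length : ℕ∞))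
  exact ⟨P.1, P.2, by rw [hP, opCount, iInf_subtype']⟩

/-- If each output of `F` is an output of one of the `G i`, applied to some of the inputs, then
`F` costs at most as much as the `G i` together. -/
theorem opCount_le_sum {X J : Type u} {I : Type*} [Fintype I] {Y K : I → Type u}
    (F : (X → ℂ) → J → ℂ) (G : ∀ i, (Y i → ℂ) → K i → ℂ) (m : ∀ i, Y i → X)
    (h : ∀ j, ∃ i, ∃ k : K i, ∀ f, F f j = G i (f ∘ m i) k) :
    opCount F ≤ ∑ i, opCount (G i) := by
  by_cases htop : ∀ i, opCount (G i) ≠ ⊤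
  · choose P hP hlen using fun i => exists_program_of_opCount_ne_top (htop i)
    obtain ⟨Q, hQ, hQ'⟩ := Program.exists_concat Finset.univ
      (fun i => (P i).map (Operation.mapOperands (Operand.rename (m i))))
    have hcomp : Q.Computes F := by
      intro j
      obtain ⟨i, k, hik⟩ := h j
      obtain ⟨o, ho⟩ := hP i k
      obtain ⟨o', ho'⟩ := hQ' i (Finset.mem_univ i) (o.rename (m i))
      refine ⟨o', fun f => ?_⟩
      rw [ho', Operand.eval_rename, Program.run_rename, ho, hik]
    refine (opCount_le hcomp).trans (le_of_eq ?_)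
    rw [hQ, Nat.cast_sum]
    exact Finset.sum_congr rfl fun i _ => by rw [← hlen, List.length_map]
  · push Not at htop
    obtain ⟨i, hi⟩ := htop
    refine le_top.trans ?_
    rw [← hi]
    exact Finset.single_le_sum (f := fun i => opCount (G i)) (fun _ _ => zero_le)
      (Finset.mem_univ i)

/-! ### The natural order and the coordinates `p_b g p_a⁻¹` on `S`. -/

namespace InverseSemigroup

section Lifting

variable {S : Type u} [InverseSemigroup S]

/-- The natural partial order as a relation. -/
def NatLE (t s : S) : Prop := ∃ e : S, IsIdempotentElem e ∧ t = e * s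

/-- The witnessing idempotent can always be taken to be `t t⁻¹`, so `t` is determined by its range
and by `s`. -/
theorem natLE_iff {t s : S} : NatLE t s ↔ t = t * t⁻¹ * s := by
  constructor
  · rintro ⟨e, he, h⟩
    have he' : e * e = e := he
    have het : e * t = t := by rw [h, ← mul_assoc, he']
    calc t = t * t⁻¹ * t := (mul_inv_mul t).symm
      _ = t * t⁻¹ * (e * s) := by rw [← h]
      _ = (t * t⁻¹ * e) * s := by simp only [mul_assoc]
      _ = (e * (t * t⁻¹)) * s := by rw [idem_comm (idem_mul_inv t) he]
      _ = t * t⁻¹ * s := by rw [← mul_assoc e, het]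
  · intro h
    exact ⟨_, idem_mul_inv t, h⟩

/-- The idempotent `f = t' t'⁻¹` moves to the left of `t` by conjugation: `t f = (t f t⁻¹) t`, where
`t f t⁻¹` is again idempotent. -/
theorem NatLE.mul {t s t' s' : S} (h : NatLE t s) (h' : NatLE t' s') :
    NatLE (t * t') (s * s') := by
  rw [natLE_iff] at h h'
  set f := t' * t'⁻¹ with hf
  have hfi : IsIdempotentElem f := idem_mul_inv t'
  have hff : f * f = f := hfi
  have h1 : t * f = t * f * t⁻¹ * t := by
    calc t * f = t * t⁻¹ * t * f := by rw [mul_inv_mul]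
      _ = t * ((t⁻¹ * t) * f) := by simp only [mul_assoc]
      _ = t * (f * (t⁻¹ * t)) := by rw [idem_comm (idem_inv_mul t) hfi]
      _ = t * f * t⁻¹ * t := by simp only [mul_assoc]
  refine ⟨t * f * t⁻¹, ?_, ?_⟩
  · change t * f * t⁻¹ * (t * f * t⁻¹) = t * f * t⁻¹
    calc t * f * t⁻¹ * (t * f * t⁻¹) = (t * f * t⁻¹ * t) * f * t⁻¹ := by simp only [mul_assoc]
      _ = t * (f * f) * t⁻¹ := by rw [← h1]; simp only [mul_assoc]
      _ = t * f * t⁻¹ := by rw [hff]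
  · calc t * t' = t * f * s' := by rw [mul_assoc, ← h']
      _ = t * f * t⁻¹ * t * s' := by rw [← h1]
      _ = t * f * t⁻¹ * (t * t⁻¹ * s) * s' := by rw [← h]
      _ = t * f * (t⁻¹ * t * t⁻¹) * s * s' := by simp only [mul_assoc]
      _ = t * f * t⁻¹ * (s * s') := by rw [inv_mul_inv]; simp only [mul_assoc]

theorem dClass_eq_of_ran {k : DClass S} {b : DIdem k} {t : S} (h : ran t = b.1) :
    dClass t = k := by
  rw [← dClass_ran t, h]
  exact b.2

theorem isoIdem_of_dClass {k : DClass S} (a b : DIdem k) : IsoIdem a.1 b.1 := by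
  have h : dClass a.1.1 = dClass b.1.1 := a.2.trans b.2.symm
  rwa [dClass_eq_iff, dom_idem, dom_idem] at h

theorem nonempty_isoChoice (e : ∀ k : DClass S, DIdem k) : Nonempty (IsoChoice e) := by
  choose p hp using fun (k : DClass S) (a : DIdem k) => isoIdem_of_dClass (e k) a
  exact ⟨⟨p, fun k a => (hp k a).1, fun k a => (hp k a).2⟩⟩

variable {e : ∀ k : DClass S, DIdem k} (c : IsoChoice e)

theorem IsoChoice.inv_mul (k : DClass S) (a : DIdem k) : (c.p k a)⁻¹ * c.p k a = (e k).1.1 :=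
  congrArg Subtype.val (c.dom_p k a)

theorem IsoChoice.mul_inv (k : DClass S) (a : DIdem k) : c.p k a * (c.p k a)⁻¹ = a.1.1 :=
  congrArg Subtype.val (c.ran_p k a)

/-- The element `p_b g p_a⁻¹` of `S`. -/
def IsoChoice.lift (k : DClass S) (b a : DIdem k) (g : MaxSubgroup (e k).1) : S :=
  c.p k b * g.1 * (c.p k a)⁻¹

theorem IsoChoice.lift_mul_lift (k : DClass S) (b d a : DIdem k) (g h : MaxSubgroup (e k).1) :
    c.lift k b d g * c.lift k d a h = c.lift k b a (g * h) := by
  unfold IsoChoice.lift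
  change _ = c.p k b * (g.1 * h.1) * (c.p k a)⁻¹
  calc c.p k b * g.1 * (c.p k d)⁻¹ * (c.p k d * h.1 * (c.p k a)⁻¹)
      = c.p k b * g.1 * ((c.p k d)⁻¹ * c.p k d * h.1) * (c.p k a)⁻¹ := by simp only [mul_assoc]
    _ = c.p k b * (g.1 * h.1) * (c.p k a)⁻¹ := by
        rw [c.inv_mul, h.one_mul']; simp only [mul_assoc]

theorem IsoChoice.lift_inv (k : DClass S) (b a : DIdem k) (g : MaxSubgroup (e k).1) :
    (c.lift k b a g)⁻¹ = c.lift k a b g⁻¹ := by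
  unfold IsoChoice.lift
  rw [mul_inv_rev', mul_inv_rev', inv_inv', mul_assoc]
  rfl

theorem IsoChoice.lift_one (k : DClass S) (a : DIdem k) : c.lift k a a 1 = a.1.1 := by
  change c.p k a * (e k).1.1 * (c.p k a)⁻¹ = _
  rw [← c.inv_mul k a, ← mul_assoc, mul_inv_mul, c.mul_inv]

theorem IsoChoice.ran_lift (k : DClass S) (b a : DIdem k) (g : MaxSubgroup (e k).1) :
    ran (c.lift k b a g) = b.1 := by
  refine Subtype.ext ?_
  change c.lift k b a g * (c.lift k b a g)⁻¹ = b.1.1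
  rw [c.lift_inv, c.lift_mul_lift, mul_inv_cancel, c.lift_one]

theorem IsoChoice.dom_lift (k : DClass S) (b a : DIdem k) (g : MaxSubgroup (e k).1) :
    dom (c.lift k b a g) = a.1 := by
  refine Subtype.ext ?_
  change (c.lift k b a g)⁻¹ * c.lift k b a g = a.1.1
  rw [c.lift_inv, c.lift_mul_lift, inv_mul_cancel, c.lift_one]

theorem IsoChoice.conj_lift (k : DClass S) (b a : DIdem k) (g : MaxSubgroup (e k).1) :
    (c.p k b)⁻¹ * c.lift k b a g * c.p k a = g.1 := by
  unfold IsoChoice.lift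
  calc (c.p k b)⁻¹ * (c.p k b * g.1 * (c.p k a)⁻¹) * c.p k a
      = ((c.p k b)⁻¹ * c.p k b) * g.1 * ((c.p k a)⁻¹ * c.p k a) := by simp only [mul_assoc]
    _ = g.1 := by rw [c.inv_mul, c.inv_mul, g.one_mul', g.mul_one']

theorem IsoChoice.lift_injective {k : DClass S} {b a b' a' : DIdem k}
    {g g' : MaxSubgroup (e k).1} (h : c.lift k b a g = c.lift k b' a' g') :
    b = b' ∧ a = a' ∧ g = g' := by
  have hb : b = b' := Subtype.ext (by rw [← c.ran_lift k b a g, h, c.ran_lift])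
  have ha : a = a' := Subtype.ext (by rw [← c.dom_lift k b a g, h, c.dom_lift])
  subst hb ha
  exact ⟨rfl, rfl, Subtype.ext (by rw [← c.conj_lift k b a g, h, c.conj_lift])⟩

/-- Together with `lift_injective` this makes `(k, b, a, g)` a system of coordinates on `S`. -/
theorem IsoChoice.lift_conj (s : S) : c.lift (dClass s) (ranD s) (domD s) (c.conj s) = s := by
  have h2 : c.p _ (ranD s) * (c.p _ (ranD s))⁻¹ = s * s⁻¹ := c.mul_inv _ (ranD s)
  have h4 : c.p _ (domD s) * (c.p _ (domD s))⁻¹ = s⁻¹ * s := c.mul_inv _ (domD s)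
  change c.p _ (ranD s) * ((c.p _ (ranD s))⁻¹ * s * c.p _ (domD s)) * (c.p _ (domD s))⁻¹ = s
  calc _ = (c.p _ (ranD s) * (c.p _ (ranD s))⁻¹) * s * (c.p _ (domD s) * (c.p _ (domD s))⁻¹) := by
        simp only [mul_assoc]
    _ = s := by rw [h2, h4, mul_inv_mul, ← mul_assoc, mul_inv_mul]

theorem IsoChoice.lift_eq_iff {s : S} {b a : DIdem (dClass s)}
    {g : MaxSubgroup (e (dClass s)).1} :
    c.lift (dClass s) b a g = s ↔ ranD s = b ∧ domD s = a ∧ c.conj s = g := by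
  constructor
  · intro h
    exact c.lift_injective ((c.lift_conj s).trans h.symm)
  · rintro ⟨rfl, rfl, rfl⟩
    exact c.lift_conj s

theorem IsoChoice.dClass_lift (k : DClass S) (b a : DIdem k) (g : MaxSubgroup (e k).1) :
    dClass (c.lift k b a g) = k :=
  dClass_eq_of_ran (c.ran_lift k b a g)

theorem IsoChoice.exists_lift {k : DClass S} {b : DIdem k} {t : S} (h : ran t = b.1) :
    ∃ a g, c.lift k b a g = t := by
  have hk := dClass_eq_of_ran h
  subst hk
  obtain rfl : ranD t = b := Subtype.ext h
  exact ⟨domD t, c.conj t, c.lift_conj t⟩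

/-- With `u` the given element below `s s'`, the left factor is `b s`; the right factor is then
forced to be `(b s)⁻¹ u`. -/
theorem IsoChoice.exists_lift_le_mul {s s' : S} {k : DClass S} {b a : DIdem k}
    {x : MaxSubgroup (e k).1} (hx : NatLE (c.lift k b a x) (s * s')) :
    ∃ d g, NatLE (c.lift k b d g) s ∧ NatLE (c.lift k d a (g⁻¹ * x)) s' := by
  have hb : IsIdempotentElem b.1.1 := b.1.2
  have hbb : b.1.1 * b.1.1 = b.1.1 := hb
  set u := c.lift k b a x with hu
  have hru : u * u⁻¹ = b.1.1 := congrArg Subtype.val (c.ran_lift k b a x)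
  rw [natLE_iff, hru] at hx
  -- The range `b` of `u` lies below the range of `s`, because `s s⁻¹` fixes `u = b s s'`. Hence `b
  -- s` has range exactly `b`.
  have hbs : b.1.1 * (s * s⁻¹) = b.1.1 := by
    have h1 : (s * s⁻¹) * u = u := by
      calc (s * s⁻¹) * u = (s * s⁻¹ * b.1.1) * (s * s') := by
            conv_lhs => rw [hx]
            simp only [mul_assoc]
        _ = b.1.1 * (s * s⁻¹ * s) * s' := by
            rw [idem_comm (idem_mul_inv s) hb]; simp only [mul_assoc]
        _ = u := by rw [mul_inv_mul, mul_assoc, ← hx]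
    calc b.1.1 * (s * s⁻¹) = (s * s⁻¹) * (u * u⁻¹) := by rw [hru, idem_comm hb (idem_mul_inv s)]
      _ = b.1.1 := by rw [← mul_assoc, h1, hru]
  have hran : ran (b.1.1 * s) = b.1 := by
    refine Subtype.ext ?_
    change b.1.1 * s * (b.1.1 * s)⁻¹ = b.1.1
    rw [mul_inv_rev', inv_idem hb]
    calc b.1.1 * s * (s⁻¹ * b.1.1) = b.1.1 * (s * s⁻¹) * b.1.1 := by simp only [mul_assoc]
      _ = b.1.1 := by rw [hbs, hbb]
  obtain ⟨d, g, hg⟩ := c.exists_lift hran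
  refine ⟨d, g, ⟨b.1.1, hb, hg⟩, ?_⟩
  -- The right factor lies below `s'` through the idempotent `s⁻¹ b s`.
  have h2 : c.lift k d a (g⁻¹ * x) = s⁻¹ * b.1.1 * s * s' := by
    rw [← c.lift_mul_lift k d b a, ← c.lift_inv, hg, ← hu, hx, mul_inv_rev', inv_idem hb]
    calc s⁻¹ * b.1.1 * (b.1.1 * (s * s')) = s⁻¹ * (b.1.1 * b.1.1) * (s * s') := by
          simp only [mul_assoc]
      _ = _ := by rw [hbb]; simp only [mul_assoc]
  refine ⟨s⁻¹ * b.1.1 * s, ?_, h2⟩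
  change s⁻¹ * b.1.1 * s * (s⁻¹ * b.1.1 * s) = s⁻¹ * b.1.1 * s
  calc s⁻¹ * b.1.1 * s * (s⁻¹ * b.1.1 * s) = s⁻¹ * (b.1.1 * (s * s⁻¹)) * b.1.1 * s := by
        simp only [mul_assoc]
    _ = s⁻¹ * (b.1.1 * b.1.1) * s := by rw [hbs]; simp only [mul_assoc]
    _ = _ := by rw [hbb]

theorem IsoChoice.lift_le_mul {s s' : S} {k : DClass S} {b d a : DIdem k}
    {g x : MaxSubgroup (e k).1} (h : NatLE (c.lift k b d g) s)
    (h' : NatLE (c.lift k d a (g⁻¹ * x)) s') : NatLE (c.lift k b a x) (s * s') := by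
  have := h.mul h'
  rwa [c.lift_mul_lift, mul_inv_cancel_left] at this

/-- Both elements lie below `s` and have range `b`, so both equal `b s`. -/
theorem IsoChoice.lift_le_unique {s : S} {k : DClass S} {b d d' : DIdem k}
    {g g' : MaxSubgroup (e k).1} (h : NatLE (c.lift k b d g) s)
    (h' : NatLE (c.lift k b d' g') s) : d = d' ∧ g = g' := by
  rw [natLE_iff] at h h'
  have h1 : c.lift k b d g * (c.lift k b d g)⁻¹ = b.1.1 :=
    congrArg Subtype.val (c.ran_lift k b d g)
  have h2 : c.lift k b d' g' * (c.lift k b d' g')⁻¹ = b.1.1 :=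
    congrArg Subtype.val (c.ran_lift k b d' g')
  exact (c.lift_injective (by rw [h, h', h1, h2])).2

end Lifting

end InverseSemigroup

/-! ### Möbius inversion and the isomorphism with the block algebra. -/

/-- The indicator restricts the sum to the interval `[q, s]`, where the defining recursion of `μ`
applies. -/
theorem sum_mu_mul_indicator {α : Type*} [PartialOrder α] [Fintype α] [LocallyFiniteOrder α]
    [DecidableEq α] [DecidableLE α] (q s : α) :
    ∑ t : α with t ≤ s, IncidenceAlgebra.mu ℂ t s * (if q ≤ t then 1 else 0) =
      if q = s then 1 else 0 := by
  rw [← IncidenceAlgebra.sum_Icc_mu_left (𝕜 := ℂ) q s]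
  simp only [mul_ite, mul_one, mul_zero]
  rw [← Finset.sum_filter]
  refine Finset.sum_congr ?_ fun _ _ => rfl
  ext t
  simp [and_comm]

theorem Finset.sum_indicator_of_unique {ι : Type*} [Fintype ι] (Q : ι → Prop) (P : Prop)
    [DecidablePred Q] [Decidable P] (h : ∀ i, Q i → P) (hex : P → ∃ i, Q i)
    (huniq : ∀ i j, Q i → Q j → i = j) :
    ∑ i, (if Q i then (1 : ℂ) else 0) = if P then 1 else 0 := by
  by_cases hP : P
  · obtain ⟨i, hi⟩ := hex hP
    rw [if_pos hP, Finset.sum_eq_single i]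
    · rw [if_pos hi]
    · intro j _ hj
      exact if_neg fun hQ => hj (huniq j i hQ hi)
    · simp
  · rw [if_neg hP]
    exact Finset.sum_eq_zero fun i _ => if_neg fun hQ => hP (h i hQ)

namespace InverseSemigroup

noncomputable section Isomorphism

variable {S : Type u} [InverseSemigroup S] [Fintype S]
variable {e : ∀ k : DClass S, DIdem k} (c : IsoChoice e)

open scoped Classical in
/-- The image of the semigroup basis element `s` in the block algebra. -/
def IsoChoice.blockOf (s : S) : BlockAlgebra e := fun k => Matrix.of fun b a =>
  ∑ g, MonoidAlgebra.single g (if NatLE (c.lift k b a g) s then 1 else 0)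

theorem sum_single_mul_sum_single {G : Type*} [Group G] [Fintype G] (f h : G → ℂ) :
    (∑ g, MonoidAlgebra.single g (f g)) * (∑ g, MonoidAlgebra.single g (h g)) =
      ∑ x, MonoidAlgebra.single x (∑ g, f g * h (g⁻¹ * x)) := by
  have hs : ∀ x : G, MonoidAlgebra.single x (∑ g, f g * h (g⁻¹ * x)) =
      ∑ g, MonoidAlgebra.single x (f g * h (g⁻¹ * x)) := fun x =>
    map_sum (MonoidAlgebra.singleAddHom x) _ _
  simp only [hs, Finset.sum_mul_sum, MonoidAlgebra.single_mul_single]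
  refine Eq.trans ?_ Finset.sum_comm
  refine Finset.sum_congr rfl fun g _ => ?_
  exact Fintype.sum_equiv (Equiv.mulLeft g) _ _ (fun x => by simp)

/-- The coefficient of `x` in the `(b, a)` entry of the product counts the pairs `(d, g)` with `p_b
g p_d⁻¹ ≤ s` and `p_d g⁻¹ x p_a⁻¹ ≤ s'`. By unique factorization there is one such pair if `p_b x
p_a⁻¹ ≤ s s'` and none otherwise. -/
theorem IsoChoice.blockOf_mul (s s' : S) : c.blockOf (s * s') = c.blockOf s * c.blockOf s' := by
  classical
  funext k
  refine Matrix.ext fun b a => ?_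
  rw [Pi.mul_apply, Matrix.mul_apply]
  simp only [blockOf, Matrix.of_apply, sum_single_mul_sum_single]
  refine Eq.trans ?_ Finset.sum_comm
  refine Finset.sum_congr rfl fun x _ => ?_
  refine Eq.trans ?_ (map_sum (MonoidAlgebra.singleAddHom x) _ _)
  change _ = MonoidAlgebra.single x _
  congr 1
  rw [← Fintype.sum_prod_type', ← Finset.sum_indicator_of_unique
    (fun i : DIdem k × MaxSubgroup (e k).1 => NatLE (c.lift k b i.1 i.2) s ∧
      NatLE (c.lift k i.1 a (i.2⁻¹ * x)) s')]
  · refine Finset.sum_congr rfl fun i _ => ?_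
    by_cases h1 : NatLE (c.lift k b i.1 i.2) s <;> simp [h1]
  · rintro ⟨d, g⟩ ⟨h, h'⟩
    exact c.lift_le_mul h h'
  · intro h
    obtain ⟨d, g, hd⟩ := c.exists_lift_le_mul h
    exact ⟨⟨d, g⟩, hd⟩
  · rintro ⟨d, g⟩ ⟨d', g'⟩ ⟨h, -⟩ ⟨h', -⟩
    obtain ⟨rfl, rfl⟩ := c.lift_le_unique h h'
    rfl

/-- The homomorphism `ℂ S → ⨁_k M_{r_k}(ℂ G_k)`. -/
def IsoChoice.blockHom : MonoidAlgebra ℂ S →ₙₐ[ℂ] BlockAlgebra e :=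
  MonoidAlgebra.liftMagma ℂ ⟨c.blockOf, c.blockOf_mul⟩

theorem IsoChoice.blockHom_single (s : S) (z : ℂ) :
    c.blockHom (MonoidAlgebra.single s z) = z • c.blockOf s := by
  simp [blockHom, MonoidAlgebra.liftMagma_apply_apply]

-- The coefficient is the sum over `t ≤ s` of `μ(t, s)` times the indicator of `p_b g p_a⁻¹ ≤ t`,
-- which Möbius inversion collapses.
open scoped Classical in
theorem IsoChoice.coeff_blockHom_groupoidElem (s : S) (k : DClass S) (b a : DIdem k)
    (g : MaxSubgroup (e k).1) :
    (c.blockHom (groupoidElem s) k b a).coeff g = if c.lift k b a g = s then 1 else 0 := by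
  -- These recreate the instances inside the definition of `groupoidElem`, so that `hg` holds by
  -- `rfl`.
  let := naturalOrder S
  let : DecidableLE S := Classical.decRel _
  let : DecidableLT S := Classical.decRel _
  let : LocallyFiniteOrder S := Fintype.toLocallyFiniteOrder
  have key := sum_mu_mul_indicator (c.lift k b a g) s
  have hg : groupoidElem s =
    ∑ t : S with t ≤ s, MonoidAlgebra.single t (IncidenceAlgebra.mu ℂ t s) := rfl
  rw [hg, map_sum, ← key, Finset.sum_apply, Matrix.sum_apply, MonoidAlgebra.coeff_sum,
    Finset.sum_apply']
  refine Finset.sum_congr rfl fun t _ => ?_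
  rw [c.blockHom_single]
  change (IncidenceAlgebra.mu ℂ t s • c.blockOf t k b a).coeff g = _
  rw [MonoidAlgebra.coeff_smul_apply, smul_eq_mul]
  congr 1
  simp only [blockOf, Matrix.of_apply]
  rw [MonoidAlgebra.coeff_sum, Finset.sum_apply']
  simp only [MonoidAlgebra.coeff_single, Finsupp.single_apply]
  rw [Finset.sum_ite_eq' Finset.univ g, if_pos (Finset.mem_univ g)]
  rfl

theorem IsoChoice.blockHom_groupoidElem (s : S) : c.blockHom (groupoidElem s) =
    Pi.single (dClass s) (Matrix.single (ranD s) (domD s)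
      (MonoidAlgebra.single (c.conj s) 1)) := by
  classical
  funext k
  ext b a g
  rw [c.coeff_blockHom_groupoidElem]
  by_cases hk : dClass s = k
  · subst hk
    rw [Pi.single_eq_same, Matrix.single_apply]
    simp only [c.lift_eq_iff]
    by_cases h1 : ranD s = b <;> by_cases h2 : domD s = a <;>
      simp [h1, h2, Finsupp.single_apply]
  · rw [Pi.single_eq_of_ne (Ne.symm hk), if_neg]
    · rfl
    · rintro rfl
      exact hk (c.dClass_lift k b a g)

theorem IsoChoice.blockHom_sum (v : S → ℂ) (k : DClass S) (b a : DIdem k) :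
    c.blockHom (∑ s, v s • groupoidElem s) k b a =
      ∑ g, v (c.p k b * g.1 * (c.p k a)⁻¹) • MonoidAlgebra.single g 1 := by
  classical
  ext g
  have h1 : (c.blockHom (∑ s, v s • groupoidElem s) k b a).coeff g = v (c.lift k b a g) := by
    rw [map_sum, Finset.sum_apply, Matrix.sum_apply, MonoidAlgebra.coeff_sum, Finset.sum_apply',
      Finset.sum_eq_single (c.lift k b a g)]
    · rw [map_smul]
      change (v _ • c.blockHom _ k b a).coeff g = _
      rw [MonoidAlgebra.coeff_smul_apply, c.coeff_blockHom_groupoidElem]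
      simp
    · intro t _ ht
      rw [map_smul]
      change (v _ • c.blockHom _ k b a).coeff g = _
      rw [MonoidAlgebra.coeff_smul_apply, c.coeff_blockHom_groupoidElem, if_neg ht.symm]
      simp
    · simp
  rw [h1, MonoidAlgebra.coeff_sum, Finset.sum_apply']
  simp [Finsupp.single_apply, lift]

/-- The coefficients of `v` in the groupoid family can be read off from the image, which gives
linear independence of that family; a dimension count makes it a basis, without inverting the Möbius
sum. -/
theorem IsoChoice.blockHom_bijective : Function.Bijective c.blockHom := by
  classical
  let T : (S → ℂ) →ₗ[ℂ] MonoidAlgebra ℂ S := Fintype.linearCombination ℂ groupoidElem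
  have hT : ∀ v, T v = ∑ s, v s • groupoidElem s := fun v =>
    Fintype.linearCombination_apply ℂ _ v
  have hcoeff : ∀ v k b a g, (c.blockHom (T v) k b a).coeff g = v (c.lift k b a g) := by
    intro v k b a g
    rw [hT, c.blockHom_sum, MonoidAlgebra.coeff_sum, Finset.sum_apply']
    simp [Finsupp.single_apply, lift]
  have hinj : Function.Injective (c.blockHom ∘ T) := by
    intro v w h
    funext s
    rw [← c.lift_conj s, ← hcoeff v, ← hcoeff w]
    exact congrArg (fun x : BlockAlgebra e => (x _ _ _).coeff _) h
  have hTsurj : Function.Surjective T := by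
    have : FiniteDimensional ℂ (MonoidAlgebra ℂ S) :=
      Module.Finite.equiv (MonoidAlgebra.coeffLinearEquiv ℂ (M := S) (S := ℂ)).symm
    refine (LinearMap.injective_iff_surjective_of_finrank_eq_finrank ?_).1 hinj.of_comp
    rw [(MonoidAlgebra.coeffLinearEquiv ℂ (M := S) (S := ℂ)).finrank_eq]
    simp
  refine ⟨?_, ?_⟩
  · intro x y h
    obtain ⟨v, rfl⟩ := hTsurj x
    obtain ⟨w, rfl⟩ := hTsurj y
    exact congrArg T (hinj h)
  · intro y
    -- The coefficient of `⌊s⌋` in the preimage is the coefficient of `y` at the coordinates of `s`.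
    refine ⟨T fun s => (y (dClass s) (ranD s) (domD s)).coeff (c.conj s), ?_⟩
    funext k
    ext b a g
    rw [hcoeff]
    -- Replacing the lift by a variable `s` allows `k` to be substituted by `dClass s`, on which the
    -- types of the coordinates depend.
    generalize hs : c.lift k b a g = s
    obtain rfl : dClass s = k := by rw [← hs, c.dClass_lift]
    obtain ⟨rfl, rfl, rfl⟩ := c.lift_eq_iff.1 hs
    rfl

end Isomorphism

end InverseSemigroup

/-! ### Irreducible representations: Schur's lemma and corners. -/

namespace MatRep

open scoped Matrix

variable {A C : Type u} [NonUnitalRing A] [Module ℂ A] [NonUnitalRing C] [Module ℂ C]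

theorem Irreducible.exists_ne_zero {ρ : MatRep A} (hρ : ρ.Irreducible) :
    ∃ w : Fin ρ.dim → ℂ, w ≠ 0 := by
  obtain ⟨a, ha⟩ := hρ.1
  by_contra! h
  refine ha (Matrix.toLin'.injective (LinearMap.ext fun w => ?_))
  rw [h w, map_zero, map_zero]

/-- An identity element of the algebra acts as the identity on an irreducible representation. -/
theorem Irreducible.hom_eq_one {ρ : MatRep A} (hρ : ρ.Irreducible) {u : A}
    (hu : ∀ a, u * a = a) (hu' : ∀ a, a * u = a) : ρ.hom u = 1 := by
  -- The range of `ρ(u)` is invariant since `u` is central. If it is zero, `ρ(a) = ρ(u a) = 0` for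
  -- all `a`; if it is everything, the idempotent `ρ(u)` is the identity.
  have hinv := hρ.2 (LinearMap.range (Matrix.mulVecLin (ρ.hom u))) (by
    rintro a _ ⟨w, rfl⟩
    refine ⟨ρ.hom a *ᵥ w, ?_⟩
    simp only [Matrix.mulVecLin_apply, Matrix.mulVec_mulVec, ← map_mul, hu, hu'])
  rcases hinv with h | h
  · obtain ⟨a, ha⟩ := hρ.1
    refine absurd ?_ ha
    have h0 : ρ.hom u = 0 := by
      refine Matrix.toLin'.injective ?_
      rw [map_zero]
      exact LinearMap.range_eq_bot.1 h
    rw [← hu a, map_mul, h0, zero_mul]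
  · refine Matrix.toLin'.injective (LinearMap.ext fun w => ?_)
    obtain ⟨w', rfl⟩ := LinearMap.range_eq_top.1 h w
    simp only [Matrix.mulVecLin_apply, Matrix.toLin'_apply, Matrix.mulVec_mulVec, ← map_mul, hu,
      Matrix.one_mul]

/-- Schur's lemma: a nonzero intertwiner of irreducible representations is an equivalence. -/
theorem Irreducible.equivalent_of_intertwiner {ρ σ : MatRep A} (hρ : ρ.Irreducible)
    (hσ : σ.Irreducible) (f : (Fin ρ.dim → ℂ) →ₗ[ℂ] (Fin σ.dim → ℂ))
    (hf : ∀ a w, f (ρ.hom a *ᵥ w) = σ.hom a *ᵥ f w) (hne : f ≠ 0) : ρ.Equivalent σ := by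
  have hker : LinearMap.ker f = ⊥ := by
    refine (hρ.2 (LinearMap.ker f) fun a w hw => ?_).resolve_right fun h =>
      hne (LinearMap.ker_eq_top.1 h)
    rw [LinearMap.mem_ker] at hw ⊢
    rw [hf, hw, Matrix.mulVec_zero]
  have hrange : LinearMap.range f = ⊤ := by
    refine (hσ.2 (LinearMap.range f) ?_).resolve_left fun h => hne (LinearMap.range_eq_bot.1 h)
    rintro a _ ⟨w, rfl⟩
    exact ⟨_, hf a w⟩
  let F : (Fin ρ.dim → ℂ) ≃ₗ[ℂ] (Fin σ.dim → ℂ) :=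
    LinearEquiv.ofBijective f ⟨LinearMap.ker_eq_bot.1 hker, LinearMap.range_eq_top.1 hrange⟩
  refine ⟨LinearMap.toMatrix' F.toLinearMap, LinearMap.toMatrix' F.symm.toLinearMap, ?_, ?_,
    fun a => ?_⟩
  · rw [← LinearMap.toMatrix'_comp]
    simp
  · rw [← LinearMap.toMatrix'_comp]
    simp
  · refine Matrix.toLin'.injective (LinearMap.ext fun w => ?_)
    rw [Matrix.toLin'_mul, Matrix.toLin'_mul, Matrix.toLin'_toMatrix', Matrix.toLin'_toMatrix']
    change f (ρ.hom a *ᵥ F.symm w) = σ.hom a *ᵥ w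
    rw [hf]
    congr 1
    exact F.apply_symm_apply w

theorem Equivalent.exists_intertwiner {ρ σ : MatRep A} (h : ρ.Equivalent σ) :
    ∃ f : (Fin ρ.dim → ℂ) →ₗ[ℂ] (Fin σ.dim → ℂ), Function.Injective f ∧
      ∀ a w, f (ρ.hom a *ᵥ w) = σ.hom a *ᵥ f w := by
  obtain ⟨X, X', -, h2, h3⟩ := h
  refine ⟨X.mulVecLin, ?_, fun a w => ?_⟩
  · refine Function.LeftInverse.injective (g := X'.mulVecLin) fun w => ?_
    simp [Matrix.mulVec_mulVec, h2]
  · simp only [Matrix.mulVecLin_apply, Matrix.mulVec_mulVec, ← h3]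
    rw [Matrix.mul_assoc _ X' X, h2, Matrix.mul_one]

/-- If `θ` identifies the unital algebra `C` with a corner `f A f` of `A` and the irreducible
representation `σ` of `A` does not vanish at `f`, then the range of `σ f` carries an irreducible
representation of `C`. -/
theorem Irreducible.exists_corner {σ : MatRep A} (hσ : σ.Irreducible) (θ : C →ₙₐ[ℂ] A) {u : C}
    (hu : ∀ x, u * x = x) (hne : σ.hom (θ u) ≠ 0)
    (hcorner : ∀ v, ∃ x, θ u * v * θ u = θ x) :
    ∃ ρ : MatRep C, ρ.Irreducible ∧ ∃ j : (Fin ρ.dim → ℂ) →ₗ[ℂ] (Fin σ.dim → ℂ),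
      Function.Injective j ∧ ∀ x w, j (ρ.hom x *ᵥ w) = σ.hom (θ x) *ᵥ j w := by
  -- `V` carries the representation of `C`: every `σ(θ x)` maps into it and `σ(θ u)` fixes it
  -- pointwise.
  set V : Submodule ℂ (Fin σ.dim → ℂ) := LinearMap.range (Matrix.mulVecLin (σ.hom (θ u))) with hV
  have hmem : ∀ x w, σ.hom (θ x) *ᵥ w ∈ V := fun x w =>
    ⟨σ.hom (θ x) *ᵥ w, by
      rw [Matrix.mulVecLin_apply, Matrix.mulVec_mulVec, ← map_mul, ← map_mul, hu]⟩
  have hfix : ∀ w ∈ V, σ.hom (θ u) *ᵥ w = w := by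
    rintro _ ⟨w, rfl⟩
    rw [Matrix.mulVecLin_apply, Matrix.mulVec_mulVec, ← map_mul, ← map_mul, hu]
  let b := Module.finBasis ℂ V
  let T : C → (V →ₗ[ℂ] V) := fun x =>
    (Matrix.mulVecLin (σ.hom (θ x))).restrict fun w _ => hmem x w
  have hT : ∀ x (w : V), (T x w : Fin σ.dim → ℂ) = σ.hom (θ x) *ᵥ (w : Fin σ.dim → ℂ) :=
    fun x w => rfl
  let ρ : MatRep C :=
    { dim := Module.finrank ℂ V
      hom :=
        { toFun := fun x => LinearMap.toMatrix b b (T x)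
          map_smul' := fun z x => by
            have : T (z • x) = z • T x := LinearMap.ext fun w => Subtype.ext (by
              simp [hT, Matrix.smul_mulVec])
            rw [this]
            simp
          map_zero' := by
            have : T 0 = 0 := LinearMap.ext fun w => Subtype.ext (by simp [hT])
            rw [this, map_zero]
          map_add' := fun x y => by
            have : T (x + y) = T x + T y := LinearMap.ext fun w => Subtype.ext (by
              simp [hT, Matrix.add_mulVec])
            rw [this, map_add]
          map_mul' := fun x y => by
            have : T (x * y) = T x ∘ₗ T y := LinearMap.ext fun w => Subtype.ext (by
              simp [hT, Matrix.mulVec_mulVec])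
            rw [this, LinearMap.toMatrix_comp b b b] } }
  let j : (Fin ρ.dim → ℂ) →ₗ[ℂ] (Fin σ.dim → ℂ) := V.subtype ∘ₗ b.equivFun.symm.toLinearMap
  have hj : Function.Injective j :=
    V.injective_subtype.comp b.equivFun.symm.injective
  have hjV : ∀ w, j w ∈ V := fun w => (b.equivFun.symm w).2
  have hjsurj : ∀ w ∈ V, ∃ w', j w' = w := fun w hw =>
    ⟨b.equivFun ⟨w, hw⟩, by simp [j]⟩
  have hint : ∀ x w, j (ρ.hom x *ᵥ w) = σ.hom (θ x) *ᵥ j w := by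
    intro x w
    obtain ⟨w', rfl⟩ := b.equivFun.surjective w
    have h1 : ρ.hom x *ᵥ b.equivFun w' = b.equivFun (T x w') :=
      LinearMap.toMatrix_mulVec_repr b b (T x) w'
    rw [h1]
    simp [j, hT]
  refine ⟨ρ, ⟨⟨u, fun h0 => hne ?_⟩, fun W hW => ?_⟩, j, hj, hint⟩
  · refine Matrix.toLin'.injective (LinearMap.ext fun w => ?_)
    obtain ⟨w', hw'⟩ := hjsurj _ (hmem u w)
    rw [Matrix.toLin'_apply, ← hfix _ (hmem u w), ← hw', ← hint, h0]
    simp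
  -- From a `C`-invariant `W`, this builds the `A`-invariant space of vectors that every `θ(u) y`
  -- sends into the copy of `W`. It contains that copy by `hcorner`, so `U = ⊥` forces `W = ⊥`; if
  -- `U = ⊤`, taking `y = θ(u)` gives `V ⊆ j(W)`.
  · let U : Submodule ℂ (Fin σ.dim → ℂ) :=
      ⨅ y : A, (W.map j).comap (Matrix.mulVecLin (σ.hom (θ u * y)))
    have hU : ∀ w, w ∈ U ↔ ∀ y, σ.hom (θ u * y) *ᵥ w ∈ W.map j := by
      intro w
      simp [U, Submodule.mem_iInf]
    rcases hσ.2 U (fun a w hw => by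
      rw [hU] at hw ⊢
      intro y
      rw [Matrix.mulVec_mulVec, ← map_mul, mul_assoc]
      exact hw _) with h | h
    · left
      rw [eq_bot_iff]
      intro w hw
      have hmemU : j w ∈ U := by
        rw [hU]
        intro y
        obtain ⟨x, hx⟩ := hcorner y
        rw [← hfix _ (hjV w), Matrix.mulVec_mulVec, ← map_mul, hx, ← hint]
        exact ⟨_, hW x w hw, rfl⟩
      rw [h, Submodule.mem_bot] at hmemU
      exact hj (hmemU.trans (map_zero j).symm)
    · right
      rw [eq_top_iff]
      intro w _
      have hmemU : j w ∈ U := h ▸ Submodule.mem_top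
      have := (hU _).1 hmemU (θ u)
      rw [← map_mul, hu, hfix _ (hjV w)] at this
      obtain ⟨w', hw', h'⟩ := this
      rwa [← hj h']

end MatRep

/-! ### Induced representations and their completeness. -/

namespace InverseSemigroup

noncomputable section Induced

open scoped Matrix

variable {S : Type u} [InverseSemigroup S] [Fintype S] {e : ∀ k : DClass S, DIdem k}
  {Φ : MonoidAlgebra ℂ S →ₙₐ[ℂ] BlockAlgebra e} (hΦ : Function.Bijective Φ)
  (ν : ∀ k : DClass S, DIdem k ≃ Fin (numIdem k))

/-- The element of `ℂ S` that corresponds to the matrix `x E_{b,a}` in the `k`-th block. -/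
def blockElem (k : DClass S) (b a : DIdem k) (x : MonoidAlgebra ℂ (MaxSubgroup (e k).1)) :
    MonoidAlgebra ℂ S :=
  (hΦ.2 (Pi.single k (Matrix.single b a x))).choose

theorem map_blockElem (k : DClass S) (b a : DIdem k)
    (x : MonoidAlgebra ℂ (MaxSubgroup (e k).1)) :
    Φ (blockElem hΦ k b a x) = Pi.single k (Matrix.single b a x) :=
  (hΦ.2 (Pi.single k (Matrix.single b a x))).choose_spec

theorem mul_blockElem (v : MonoidAlgebra ℂ S) (k : DClass S) (a d : DIdem k)
    (x : MonoidAlgebra ℂ (MaxSubgroup (e k).1)) :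
    v * blockElem hΦ k a d x = ∑ b, blockElem hΦ k b d (Φ v k b a * x) := by
  refine hΦ.1 ?_
  rw [map_mul, map_sum, map_blockElem]
  simp only [map_blockElem]
  funext k'
  rw [Pi.mul_apply, Finset.sum_apply]
  by_cases h : k' = k
  · subst h
    simp only [Pi.single_eq_same]
    refine Matrix.ext fun i j => ?_
    rw [Matrix.sum_apply, Matrix.mul_apply]
    simp only [Matrix.single_apply]
    rw [Finset.sum_eq_single a (by intro b _ hb; simp [hb.symm]) (by simp),
      Finset.sum_eq_single i (by intro b _ hb; simp [hb]) (by simp)]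
    by_cases hd : d = j <;> simp [hd]
  · simp [Pi.single_eq_of_ne h]

theorem blockElem_mul_blockElem (k : DClass S) (b d a : DIdem k)
    (x y : MonoidAlgebra ℂ (MaxSubgroup (e k).1)) :
    blockElem hΦ k b d x * blockElem hΦ k d a y = blockElem hΦ k b a (x * y) := by
  refine hΦ.1 ?_
  rw [map_mul]
  simp only [map_blockElem]
  rw [← Pi.single_mul, Matrix.single_mul_single_same]

/-- Matrix units on both sides pick out one entry of `v`. On the diagonal this is the corner
condition required by `Irreducible.exists_corner`. -/
theorem blockElem_mul_mul_blockElem (v : MonoidAlgebra ℂ S) (k : DClass S) (b d a c : DIdem k)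
    (x y : MonoidAlgebra ℂ (MaxSubgroup (e k).1)) :
    blockElem hΦ k b d x * v * blockElem hΦ k a c y =
      blockElem hΦ k b c (x * Φ v k d a * y) := by
  rw [mul_blockElem, Finset.sum_eq_single b]
  · congr 1
    rw [map_mul, map_blockElem, Pi.mul_apply, Pi.single_eq_same, Matrix.single_mul_apply_same]
  · intro b' _ hb
    rw [map_mul, map_blockElem, Pi.mul_apply, Pi.single_eq_same,
      Matrix.single_mul_apply_of_ne _ _ _ _ _ hb, zero_mul]
    refine hΦ.1 ?_
    rw [map_blockElem]
    simp
  · simp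

theorem eq_sum_blockElem (v : MonoidAlgebra ℂ S) :
    v = ∑ k, ∑ b, ∑ a, blockElem hΦ k b a (Φ v k b a) := by
  refine hΦ.1 ?_
  simp only [map_sum, map_blockElem]
  conv_lhs => rw [← Finset.univ_sum_single (Φ v)]
  refine Finset.sum_congr rfl fun k _ => ?_
  conv_lhs => rw [Matrix.matrix_eq_sum_single (Φ v k)]
  change AddMonoidHom.single _ k _ = ∑ b, ∑ a, AddMonoidHom.single _ k _
  simp only [map_sum]

/-- The diagonal corner of `ℂ S` at the idempotent `a` of the `k`-th block. -/
def cornerHom (k : DClass S) (a : DIdem k) :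
    MonoidAlgebra ℂ (MaxSubgroup (e k).1) →ₙₐ[ℂ] MonoidAlgebra ℂ S where
  toFun := blockElem hΦ k a a
  map_smul' z x := hΦ.1 (by
    rw [map_smul, map_blockElem, map_blockElem]
    change Pi.single k _ = z • Pi.single k _
    rw [← Pi.single_smul, Matrix.smul_single])
  map_zero' := hΦ.1 (by rw [map_blockElem]; simp)
  map_add' x y := hΦ.1 (by
    rw [map_add, map_blockElem, map_blockElem, map_blockElem, ← Pi.single_add,
      Matrix.single_add])
  map_mul' x y := (blockElem_mul_blockElem hΦ k a a a x y).symm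

variable (Φ) in
/-- The decomposition of a vector of an induced representation into blocks. -/
def blocks (k : DClass S) (ρ : MatRep (MonoidAlgebra ℂ (MaxSubgroup (e k).1))) :
    (Fin (induced Φ ν k ρ).dim → ℂ) ≃ₗ[ℂ] (DIdem k → Fin ρ.dim → ℂ) :=
  (LinearEquiv.funCongrLeft ℂ ℂ (blockIndex (ν k) ρ.dim)).trans (LinearEquiv.curry ℂ ℂ _ _)

theorem induced_hom_apply (k : DClass S) (ρ : MatRep (MonoidAlgebra ℂ (MaxSubgroup (e k).1)))
    (v : MonoidAlgebra ℂ S) (b a : DIdem k) (i j : Fin ρ.dim) :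
    (induced Φ ν k ρ).hom v (blockIndex (ν k) ρ.dim (b, i)) (blockIndex (ν k) ρ.dim (a, j)) =
      ρ.hom (Φ v k b a) i j := by
  change ρ.hom (Φ v k
    ((blockIndex (ν k) ρ.dim).symm (blockIndex (ν k) ρ.dim (b, i))).1
    ((blockIndex (ν k) ρ.dim).symm (blockIndex (ν k) ρ.dim (a, j))).1)
    ((blockIndex (ν k) ρ.dim).symm (blockIndex (ν k) ρ.dim (b, i))).2
    ((blockIndex (ν k) ρ.dim).symm (blockIndex (ν k) ρ.dim (a, j))).2 = _
  simp only [Equiv.symm_apply_apply]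

theorem blocks_mulVec (k : DClass S) (ρ : MatRep (MonoidAlgebra ℂ (MaxSubgroup (e k).1)))
    (v : MonoidAlgebra ℂ S) (w : Fin (induced Φ ν k ρ).dim → ℂ) (b : DIdem k) :
    blocks Φ ν k ρ ((induced Φ ν k ρ).hom v *ᵥ w) b =
      ∑ a, ρ.hom (Φ v k b a) *ᵥ blocks Φ ν k ρ w a := by
  funext i
  rw [Finset.sum_apply]
  change ∑ n, (induced Φ ν k ρ).hom v (blockIndex (ν k) ρ.dim (b, i)) n * w n = _
  refine Eq.trans ((blockIndex (ν k) ρ.dim).sum_comp _).symm ?_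
  rw [Fintype.sum_prod_type]
  refine Finset.sum_congr rfl fun a _ => ?_
  refine Finset.sum_congr rfl fun j _ => ?_
  rw [induced_hom_apply]
  rfl

theorem blocks_blockElem_mulVec (k : DClass S)
    (ρ : MatRep (MonoidAlgebra ℂ (MaxSubgroup (e k).1))) (b a : DIdem k)
    (x : MonoidAlgebra ℂ (MaxSubgroup (e k).1)) (w : Fin (induced Φ ν k ρ).dim → ℂ) :
    blocks Φ ν k ρ ((induced Φ ν k ρ).hom (blockElem hΦ k b a x) *ᵥ w) =
      Pi.single b (ρ.hom x *ᵥ blocks Φ ν k ρ w a) := by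
  funext b'
  rw [blocks_mulVec, map_blockElem, Pi.single_eq_same]
  by_cases h : b = b'
  · subst h
    rw [Pi.single_eq_same, Finset.sum_eq_single a]
    · rw [Matrix.single_apply_same]
    · intro a' _ ha
      rw [Matrix.single_apply_of_col_ne _ _ ha.symm, map_zero, Matrix.zero_mulVec]
    · simp
  · rw [Pi.single_eq_of_ne (Ne.symm h)]
    refine Finset.sum_eq_zero fun a' _ => ?_
    rw [Matrix.single_apply_of_row_ne h, map_zero, Matrix.zero_mulVec]

theorem induced_blockElem_of_ne {k k' : DClass S} (h : k ≠ k')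
    (ρ : MatRep (MonoidAlgebra ℂ (MaxSubgroup (e k).1))) (b a : DIdem k')
    (x : MonoidAlgebra ℂ (MaxSubgroup (e k').1)) :
    (induced Φ ν k ρ).hom (blockElem hΦ k' b a x) = 0 := by
  refine Matrix.toLin'.injective (LinearMap.ext fun w => (blocks Φ ν k ρ).injective ?_)
  rw [Matrix.toLin'_apply]
  funext c
  rw [blocks_mulVec, map_blockElem, Pi.single_eq_of_ne h]
  simp

-- Matrix units carry any block of a vector to any position, so an invariant subspace is governed by
-- the vectors it contains that are supported in one fixed block `o`.
include hΦ in
theorem induced_irreducible {k : DClass S} {ρ : MatRep (MonoidAlgebra ℂ (MaxSubgroup (e k).1))}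
    (hρ : ρ.Irreducible) : (induced Φ ν k ρ).Irreducible := by
  have hone : ρ.hom 1 = 1 := hρ.hom_eq_one one_mul mul_one
  set D := blocks Φ ν k ρ with hD
  obtain ⟨o⟩ : Nonempty (DIdem k) := ⟨e k⟩
  refine ⟨⟨blockElem hΦ k o o 1, fun h0 => ?_⟩, fun W hW => ?_⟩
  · obtain ⟨w, hw⟩ := hρ.exists_ne_zero
    have := blocks_blockElem_mulVec hΦ ν k ρ o o 1 (D.symm (Pi.single o w))
    rw [h0, Matrix.zero_mulVec, ← hD, map_zero, LinearEquiv.apply_symm_apply, hone,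
      Pi.single_eq_same, Matrix.one_mulVec] at this
    exact hw (Pi.single_eq_zero_iff.1 this.symm)
  · have hmove : ∀ b a x w, w ∈ W → D.symm (Pi.single b (ρ.hom x *ᵥ D w a)) ∈ W := by
      intro b a x w hw
      rw [hD, ← blocks_blockElem_mulVec hΦ, LinearEquiv.symm_apply_apply]
      exact hW _ _ hw
    -- The vectors whose copy in block `o` lies in `W`. If `W' = ⊥`, every block of every element of
    -- `W` vanishes; if `W' = ⊤`, any vector is a sum of its blocks, each moved into place from `o`.
    let W' : Submodule ℂ (Fin ρ.dim → ℂ) :=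
      W.comap (D.symm.toLinearMap ∘ₗ LinearMap.single ℂ (fun _ => Fin ρ.dim → ℂ) o)
    have hW' : ∀ w, w ∈ W' ↔ D.symm (Pi.single o w) ∈ W := fun w => Iff.rfl
    rcases hρ.2 W' (fun x w hw => by
      have := hmove o o x _ ((hW' w).1 hw)
      rwa [LinearEquiv.apply_symm_apply, Pi.single_eq_same] at this) with h | h
    · left
      rw [eq_bot_iff]
      intro w hw
      rw [Submodule.mem_bot]
      refine D.injective ?_
      rw [map_zero]
      funext a
      have := hmove o a 1 w hw
      rw [hone, Matrix.one_mulVec, ← hW', h, Submodule.mem_bot] at this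
      exact this
    · right
      rw [eq_top_iff]
      intro w _
      have hb : ∀ b, D.symm (Pi.single b (D w b)) ∈ W := by
        intro b
        have h1 : D.symm (Pi.single o (D w b)) ∈ W := by
          rw [← hW', h]
          exact Submodule.mem_top
        have := hmove b o 1 _ h1
        rwa [LinearEquiv.apply_symm_apply, Pi.single_eq_same, hone, Matrix.one_mulVec] at this
      have hsum : w = ∑ b, D.symm (Pi.single b (D w b)) := by
        rw [← map_sum, Finset.univ_sum_single, LinearEquiv.symm_apply_apply]
      rw [hsum]
      exact Submodule.sum_mem _ fun b _ => hb b

-- For distinct classes, the diagonal matrix unit at `e_k` acts as zero on one induced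
-- representation and not on the other.
include hΦ in
theorem eq_of_induced_equivalent {k k' : DClass S}
    {ρ : MatRep (MonoidAlgebra ℂ (MaxSubgroup (e k).1))}
    {ρ' : MatRep (MonoidAlgebra ℂ (MaxSubgroup (e k').1))} (hρ : ρ.Irreducible)
    (h : (induced Φ ν k ρ).Equivalent (induced Φ ν k' ρ')) : k = k' := by
  by_contra hk
  obtain ⟨F, hF, hFint⟩ := h.exists_intertwiner
  obtain ⟨w, hw⟩ := hρ.exists_ne_zero
  have hone : ρ.hom 1 = 1 := hρ.hom_eq_one one_mul mul_one
  set ι := (blocks Φ ν k ρ).symm (Pi.single (e k) w) with hι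
  have h1 := blocks_blockElem_mulVec hΦ ν k ρ (e k) (e k) 1 ι
  have h2 := hFint (blockElem hΦ k (e k) (e k) 1) ι
  rw [induced_blockElem_of_ne hΦ ν (Ne.symm hk), Matrix.zero_mulVec] at h2
  rw [hF (h2.trans (map_zero F).symm), map_zero, hι, LinearEquiv.apply_symm_apply,
    Pi.single_eq_same, hone, Matrix.one_mulVec] at h1
  exact hw (Pi.single_eq_zero_iff.1 h1.symm)

-- An intertwiner of induced representations commutes with the projection to block `o`; its
-- restriction to that block intertwines `ρ` and `ρ'`, and Schur's lemma applies.
include hΦ in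
theorem equivalent_of_induced_equivalent {k : DClass S}
    {ρ ρ' : MatRep (MonoidAlgebra ℂ (MaxSubgroup (e k).1))} (hρ : ρ.Irreducible)
    (hρ' : ρ'.Irreducible) (h : (induced Φ ν k ρ).Equivalent (induced Φ ν k ρ')) :
    ρ.Equivalent ρ' := by
  obtain ⟨F, hF, hFint⟩ := h.exists_intertwiner
  have hone : ρ.hom 1 = 1 := hρ.hom_eq_one one_mul mul_one
  set D := blocks Φ ν k ρ with hD
  set D' := blocks Φ ν k ρ' with hD'
  obtain ⟨o⟩ : Nonempty (DIdem k) := ⟨e k⟩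
  let ι : (Fin ρ.dim → ℂ) →ₗ[ℂ] (Fin (induced Φ ν k ρ).dim → ℂ) :=
    D.symm.toLinearMap ∘ₗ LinearMap.single ℂ (fun _ => Fin ρ.dim → ℂ) o
  have hι : ∀ w, D (ι w) = Pi.single o w := fun w => D.apply_symm_apply _
  have hιx : ∀ x w, ι (ρ.hom x *ᵥ w) = (induced Φ ν k ρ).hom (blockElem hΦ k o o x) *ᵥ ι w := by
    intro x w
    refine D.injective ?_
    rw [hι, hD, blocks_blockElem_mulVec, ← hD, hι, Pi.single_eq_same]
  -- For `x = 1` this says that `F ∘ ι` lands in block `o`; thus `g = 0` would force `F (ι w) = 0`.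
  have hDF : ∀ x w, D' (F (ι (ρ.hom x *ᵥ w))) = Pi.single o (ρ'.hom x *ᵥ D' (F (ι w)) o) := by
    intro x w
    rw [hιx, hFint, hD', blocks_blockElem_mulVec]
  let g : (Fin ρ.dim → ℂ) →ₗ[ℂ] (Fin ρ'.dim → ℂ) :=
    LinearMap.proj o ∘ₗ D'.toLinearMap ∘ₗ F ∘ₗ ι
  have hg : ∀ w, g w = D' (F (ι w)) o := fun w => rfl
  refine hρ.equivalent_of_intertwiner hρ' g (fun x w => ?_) fun h0 => ?_
  · rw [hg, hDF, Pi.single_eq_same, hg]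
  · obtain ⟨w, hw⟩ := hρ.exists_ne_zero
    have h1 := hDF 1 w
    rw [← hg, h0, LinearMap.zero_apply, Matrix.mulVec_zero, Pi.single_zero, hone,
      Matrix.one_mulVec] at h1
    have h2 : ι w = 0 := hF ((D'.injective (h1.trans (map_zero D').symm)).trans (map_zero F).symm)
    have h3 := hι w
    rw [h2, map_zero] at h3
    exact hw (Pi.single_eq_zero_iff.1 h3.symm)

-- Every matrix unit of block `k` factors through the corner at `e_k`; if `σ` vanished on all these
-- corners, it would vanish on `ℂ S`.
include hΦ in
theorem exists_corner_ne_zero {σ : MatRep (MonoidAlgebra ℂ S)} (hσ : σ.Irreducible) :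
    ∃ k, σ.hom (blockElem hΦ k (e k) (e k) 1) ≠ 0 := by
  by_contra! h
  obtain ⟨v, hv⟩ := hσ.1
  refine hv ?_
  rw [eq_sum_blockElem hΦ v]
  simp only [map_sum]
  refine Finset.sum_eq_zero fun k _ => Finset.sum_eq_zero fun b _ => Finset.sum_eq_zero
    fun a _ => ?_
  have : blockElem hΦ k b a (Φ v k b a) = blockElem hΦ k b (e k) 1 *
      blockElem hΦ k (e k) (e k) 1 * blockElem hΦ k (e k) a (Φ v k b a) := by
    rw [blockElem_mul_blockElem, blockElem_mul_blockElem, one_mul, one_mul]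
  rw [this, map_mul, map_mul, h, mul_zero, zero_mul]

/-- The map `w ↦ ∑_b σ(E_{b,e_k}) j(w_b)` is the unique extension of `j` from block `e_k`. It is an
intertwiner by `mul_blockElem`, nonzero because `j` is injective, and hence an equivalence by
Schur's lemma. -/
theorem induced_equivalent_of_corner {σ : MatRep (MonoidAlgebra ℂ S)} (hσ : σ.Irreducible)
    {k : DClass S} {ρ : MatRep (MonoidAlgebra ℂ (MaxSubgroup (e k).1))} (hρ : ρ.Irreducible)
    (j : (Fin ρ.dim → ℂ) →ₗ[ℂ] (Fin σ.dim → ℂ)) (hj : Function.Injective j)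
    (hint : ∀ x w, j (ρ.hom x *ᵥ w) = σ.hom (blockElem hΦ k (e k) (e k) x) *ᵥ j w) :
    (induced Φ ν k ρ).Equivalent σ := by
  have hone : ρ.hom 1 = 1 := hρ.hom_eq_one one_mul mul_one
  set D := blocks Φ ν k ρ with hD
  let f : (Fin (induced Φ ν k ρ).dim → ℂ) →ₗ[ℂ] (Fin σ.dim → ℂ) :=
    ∑ b, Matrix.mulVecLin (σ.hom (blockElem hΦ k b (e k) 1)) ∘ₗ j ∘ₗ LinearMap.proj b ∘ₗ
      D.toLinearMap
  have hf : ∀ w, f w = ∑ b, σ.hom (blockElem hΦ k b (e k) 1) *ᵥ j (D w b) := by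
    intro w
    simp [f]
  refine (induced_irreducible hΦ ν hρ).equivalent_of_intertwiner hσ f (fun v w => ?_) fun h0 => ?_
  · have hl : f ((induced Φ ν k ρ).hom v *ᵥ w) =
        ∑ b, ∑ a, σ.hom (blockElem hΦ k b (e k) (Φ v k b a)) *ᵥ j (D w a) := by
      rw [hf]
      refine Finset.sum_congr rfl fun b _ => ?_
      rw [hD, blocks_mulVec, map_sum, Matrix.mulVec_sum]
      refine Finset.sum_congr rfl fun a _ => ?_
      rw [hint, Matrix.mulVec_mulVec, ← map_mul, blockElem_mul_blockElem, one_mul]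
    rw [hl, hf, Matrix.mulVec_sum, Finset.sum_comm]
    refine Finset.sum_congr rfl fun a _ => ?_
    rw [Matrix.mulVec_mulVec, ← map_mul, mul_blockElem, map_sum, Matrix.sum_mulVec]
    simp only [mul_one]
  · obtain ⟨w, hw⟩ := hρ.exists_ne_zero
    have h1 : f (D.symm (Pi.single (e k) w)) = j w := by
      rw [hf, LinearEquiv.apply_symm_apply, Finset.sum_eq_single (e k)]
      · rw [Pi.single_eq_same, ← hint, hone, Matrix.one_mulVec]
      · intro b _ hb
        rw [Pi.single_eq_of_ne hb, map_zero, Matrix.mulVec_zero]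
      · simp
    rw [h0, LinearMap.zero_apply] at h1
    exact hw (hj (h1.symm.trans (map_zero j).symm))

include hΦ in
theorem isComplete_induced
    {Irr : ∀ k : DClass S, Set (MatRep (MonoidAlgebra ℂ (MaxSubgroup (e k).1)))}
    (hIrr : ∀ k, MatRep.IsComplete (Irr k)) :
    MatRep.IsComplete {σ | ∃ k, ∃ ρ ∈ Irr k, σ = induced Φ ν k ρ} := by
  refine ⟨?_, ?_, fun σ hσ => ?_⟩
  · rintro _ ⟨k, ρ, hρ, rfl⟩
    exact induced_irreducible hΦ ν ((hIrr k).1 ρ hρ)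
  · rintro _ ⟨k, ρ, hρ, rfl⟩ _ ⟨k', ρ', hρ', rfl⟩ h
    obtain rfl := eq_of_induced_equivalent hΦ ν ((hIrr k).1 ρ hρ) h
    rw [(hIrr k).2.1 ρ hρ ρ' hρ' (equivalent_of_induced_equivalent hΦ ν ((hIrr k).1 ρ hρ)
      ((hIrr k).1 ρ' hρ') h)]
  · obtain ⟨k, hk⟩ := exists_corner_ne_zero hΦ hσ
    obtain ⟨ρ, hρ, j, hj, hint⟩ := hσ.exists_corner (cornerHom hΦ k (e k)) one_mul hk
      fun v => ⟨_, blockElem_mul_mul_blockElem hΦ v k (e k) (e k) (e k) (e k) 1 1⟩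
    -- The corner representation need not belong to `Irr k`; its embedding is transported to the
    -- equivalent member.
    obtain ⟨ρ₀, hρ₀, heq⟩ := (hIrr k).2.2 ρ hρ
    obtain ⟨g, hg, hgint⟩ := heq.exists_intertwiner
    refine ⟨_, ⟨k, ρ₀, hρ₀, rfl⟩, induced_equivalent_of_corner hΦ ν hσ ((hIrr k).1 ρ₀ hρ₀)
      (j ∘ₗ g) (hj.comp hg) fun x w => ?_⟩
    rw [LinearMap.comp_apply, hgint, hint]
    rfl

end Induced

end InverseSemigroup

/-! ### The bound on the number of operations. -/

theorem exists_isComplete_semigroupCost_eq {G : Type u} [Semigroup G] [Fintype G]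
    (h : semigroupComplexity G ≠ ⊤) :
    ∃ Y : Set (MatRep (MonoidAlgebra ℂ G)), MatRep.IsComplete Y ∧
      semigroupCost G Y = semigroupComplexity G := by
  have hne : Nonempty {Y : Set (MatRep (MonoidAlgebra ℂ G)) // MatRep.IsComplete Y} := by
    by_contra hcon
    exact h (iInf₂_eq_top.2 fun Y hY => (hcon ⟨⟨Y, hY⟩⟩).elim)
  obtain ⟨Y, hY⟩ := ENat.exists_eq_iInf
    (fun Y : {Y : Set (MatRep (MonoidAlgebra ℂ G)) // MatRep.IsComplete Y} => semigroupCost G Y.1)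
  exact ⟨Y.1, Y.2, by rw [hY, semigroupComplexity, iInf_subtype']⟩

namespace InverseSemigroup

variable {S : Type u} [InverseSemigroup S] [Fintype S] {e : ∀ k : DClass S, DIdem k}

theorem IsoChoice.induced_hom_sum (c : IsoChoice e)
    (ν : ∀ k : DClass S, DIdem k ≃ Fin (numIdem k)) (v : S → ℂ) (k : DClass S)
    (ρ : MatRep (MonoidAlgebra ℂ (MaxSubgroup (e k).1))) (b a : DIdem k) (i j : Fin ρ.dim) :
    (induced c.blockHom ν k ρ).hom (∑ s, v s • groupoidElem s)
        (blockIndex (ν k) ρ.dim (b, i)) (blockIndex (ν k) ρ.dim (a, j)) =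
      ρ.hom (∑ g : MaxSubgroup (e k).1,
        v (c.p k b * g.1 * (c.p k a)⁻¹) • MonoidAlgebra.single g 1) i j := by
  rw [induced_hom_apply, c.blockHom_sum]

/-- One group transform is run for each pair `(b, a)`, with input `g` renamed to `p_b g p_a⁻¹`; it
serves all `ρ ∈ Irr k` at once. -/
theorem IsoChoice.groupoidCost_induced_le (c : IsoChoice e)
    (ν : ∀ k : DClass S, DIdem k ≃ Fin (numIdem k))
    (Irr : ∀ k : DClass S, Set (MatRep (MonoidAlgebra ℂ (MaxSubgroup (e k).1)))) :
    groupoidCost {σ | ∃ k, ∃ ρ ∈ Irr k, σ = induced c.blockHom ν k ρ} ≤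
      ∑ k : DClass S, (numIdem k : ℕ∞) ^ 2 * semigroupCost (MaxSubgroup (e k).1) (Irr k) := by
  have hsum : ∑ k : DClass S,
      (numIdem k : ℕ∞) ^ 2 * semigroupCost (MaxSubgroup (e k).1) (Irr k) =
      ∑ x : Σ k : DClass S, DIdem k × DIdem k,
        semigroupCost (MaxSubgroup (e x.1).1) (Irr x.1) := by
    rw [Fintype.sum_sigma]
    refine Finset.sum_congr rfl fun k _ => ?_
    refine Eq.trans ?_ (Finset.sum_const (semigroupCost (MaxSubgroup (e k).1) (Irr k))).symm
    rw [Finset.card_univ, Fintype.card_prod, nsmul_eq_mul, sq, Nat.cast_mul]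
    rfl
  rw [hsum]
  refine opCount_le_sum _ _ (fun x g => c.lift x.1 x.2.1 x.2.2 g) ?_
  rintro ⟨⟨_, k, ρ, hρ, rfl⟩, i, j⟩
  obtain ⟨⟨b, i⟩, rfl⟩ := (blockIndex (ν k) ρ.dim).surjective i
  obtain ⟨⟨a, j⟩, rfl⟩ := (blockIndex (ν k) ρ.dim).surjective j
  exact ⟨⟨k, b, a⟩, ⟨⟨ρ, hρ⟩, i, j⟩, fun f => c.induced_hom_sum ν f k ρ b a i j⟩

theorem groupoidComplexity_le (e : ∀ k : DClass S, DIdem k) :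
    groupoidComplexity S ≤
      ∑ k : DClass S, (numIdem k : ℕ∞) ^ 2 * semigroupComplexity (MaxSubgroup (e k).1) := by
  by_cases htop : ∀ k : DClass S, semigroupComplexity (MaxSubgroup (e k).1) ≠ ⊤
  · choose Irr hIrr hcost using fun k => exists_isComplete_semigroupCost_eq (htop k)
    obtain ⟨c⟩ := nonempty_isoChoice e
    let ν : ∀ k : DClass S, DIdem k ≃ Fin (numIdem k) := fun k => Fintype.equivFin (DIdem k)
    refine (iInf₂_le _ (isComplete_induced c.blockHom_bijective ν hIrr)).trans ?_
    refine (c.groupoidCost_induced_le ν Irr).trans (le_of_eq ?_)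
    exact Finset.sum_congr rfl fun k _ => by rw [hcost]
  · push Not at htop
    obtain ⟨k, hk⟩ := htop
    -- Since `0 * ⊤ = 0` in `ℕ∞`, the right side is infinite only because `r_k` is positive, as
    -- `e_k` witnesses.
    have hr : (numIdem k : ℕ∞) ^ 2 ≠ 0 := by
      have : numIdem k ≠ 0 := (Fintype.card_pos_iff.2 ⟨e k⟩).ne'
      exact pow_ne_zero 2 (by exact_mod_cast this)
    refine le_top.trans ?_
    rw [← ENat.mul_top hr, ← hk]
    exact Finset.single_le_sum
      (f := fun k => (numIdem k : ℕ∞) ^ 2 * semigroupComplexity (MaxSubgroup (e k).1))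
      (fun _ _ => zero_le) (Finset.mem_univ k)

end InverseSemigroup

theorem mainTheorem4 {S : Type u} [InverseSemigroup S] [Fintype S]
    (e : ∀ k : DClass S, DIdem k) :
    -- the bound on the number of operations
    groupoidComplexity S ≤
        ∑ k : DClass S, (numIdem k : ℕ∞) ^ 2 * semigroupComplexity (MaxSubgroup (e k).1) ∧
    -- how the bound is reached
    Nonempty (IsoChoice e) ∧
    ∀ (c : IsoChoice e) (ν : ∀ k : DClass S, DIdem k ≃ Fin (numIdem k)),
      ∃ Φ : MonoidAlgebra ℂ S →ₙₐ[ℂ] BlockAlgebra e,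
        -- `Φ` is the isomorphism `ℂ S ≅ ⨁_k M_{r_k}(ℂ G_k)`, `⌊s⌋ ↦ (p_b⁻¹ s p_a) E_{b,a}`
        Function.Bijective Φ ∧
        (∀ s : S, Φ (groupoidElem s) =
          Pi.single (dClass s) (Matrix.single (ranD s) (domD s)
            (MonoidAlgebra.single (c.conj s) 1))) ∧
        -- the blocks of `v` at an induced representation are Fourier transforms on `G_k`
        (∀ (v : S → ℂ) (k : DClass S) (ρ : MatRep (MonoidAlgebra ℂ (MaxSubgroup (e k).1)))
            (b a : DIdem k) (i j : Fin ρ.dim),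
          (induced Φ ν k ρ).hom (∑ s, v s • groupoidElem s)
              (blockIndex (ν k) ρ.dim (b, i)) (blockIndex (ν k) ρ.dim (a, j)) =
            ρ.hom (∑ g : MaxSubgroup (e k).1,
              v (c.p k b * g.1 * (c.p k a)⁻¹) • MonoidAlgebra.single g 1) i j) ∧
        ∀ Irr : ∀ k : DClass S, Set (MatRep (MonoidAlgebra ℂ (MaxSubgroup (e k).1))),
          (∀ k, MatRep.IsComplete (Irr k)) →
          -- the induced representations form a complete set of irreducibles of `ℂ S`, and
          -- `r_k ^ 2` Fourier transforms on each `G_k` suffice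
          MatRep.IsComplete {σ | ∃ k, ∃ ρ ∈ Irr k, σ = induced Φ ν k ρ} ∧
          groupoidCost {σ | ∃ k, ∃ ρ ∈ Irr k, σ = induced Φ ν k ρ} ≤
            ∑ k : DClass S, (numIdem k : ℕ∞) ^ 2 * semigroupCost (MaxSubgroup (e k).1) (Irr k) := by
  refine ⟨InverseSemigroup.groupoidComplexity_le e, InverseSemigroup.nonempty_isoChoice e,
    fun c ν => ⟨c.blockHom, c.blockHom_bijective, c.blockHom_groupoidElem, c.induced_hom_sum ν,
      fun Irr hIrr => ⟨?_, c.groupoidCost_induced_le ν Irr⟩⟩⟩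
  exact InverseSemigroup.isComplete_induced c.blockHom_bijective ν hIrr
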